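/- Let $A$ be an infinite dimensional simple separable unital C*-algebra, let $n \geq 1$ be an integer, and let $\alpha \in \mathrm{Aut}(A)$ satisfy $\alpha^n = \mathrm{id}_A$. Write $\mathbb{Z}/n$ for $\mathbb{Z}/n\mathbb{Z}$, and consider the action $k \mapsto \alpha^k$ of $\mathbb{Z}/n$ on $A$ generated by $\alpha$. For a projection $p \in A$ and a positive element $x \in A$, write $p \precsim \overline{xAx}$ if $p$ is Murray-von Neumann equivalent to a projection in the hereditary subalgebra $\overline{xAx}$ generated by $x$. Suppose that $\alpha$ is *strongly tracially approximately inner*: for every finite set $F \subset A$, every $\varepsilon > 0$, and every positive $x \in A$ with $\|x\| = 1$, there exist a projection $e \in A$ and a unitary $v \in eAe$ such that - $\|\alpha(e) - e\| < \varepsilon$; - $\|ea - ae\| < \varepsilon$ for all $a \in F$; - $\|v e a e v^* - \alpha(eae)\| < \varepsilon$ for all $a \in F$; - $1 - e \precsim \overline{xAx}$; - $\|exe\| > 1 - \varepsilon$. Suppose also that the action of $\mathbb{Z}/n$ generated by $\alpha$ has the *tracial Rokhlin property*: for every finite set $F \subset A$, every $\varepsilon > 0$, and every positive $x \in A$ with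 $\|x\| = 1$, there are mutually orthogonal projections $e_k \in A$ for $k \in \mathbb{Z}/n$ such that, with $e = \sum_{k} e_k$, - $\|\alpha^j(e_k) - e_{j+k}\| < \varepsilon$ for all $j, k \in \mathbb{Z}/n$; - $\|e_k a - a e_k\| < \varepsilon$ for all $k \in \mathbb{Z}/n$ and all $a \in F$; - $1 - e \precsim \overline{xAx}$; - $\|exe\| > 1 - \varepsilon$. Then the action of $\mathbb{Z}/n$ generated by $\alpha$ is *tracially approximately representable*: for every finite set $F \subset A$, every $\varepsilon > 0$, and every positive $x \in A$ with $\|x\| = 1$, there are a projection $e \in A$ and unitaries $w_k \in eAe$ for $k \in \mathbb{Z}/n$ such that - $\|ea - ae\| < \varepsilon$ for all $a \in F$; - $\|\alpha^k(eae) - w_k e a e w_k^*\| < \varepsilon$ for all $a \in F$ and all $k \in \mathbb{Z}/n$; - $\|w_j w_k - w_{j+k}\| < \varepsilon$ for all $j, k \in \mathbb{Z}/n$; - $\|\alpha^j(w_k) - w_k\| < \varepsilon$ for all $j, k \in \mathbb{Z}/n$; - $1 - e \precsim \overline{xAx}$; - $\|exe\| > 1 - \varepsilon$. -/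

import Mathlib

open scoped BigOperators

namespace TracialActions

section Basic

variable {A : Type*} [CStarAlgebra A]

/-- A C⋆-algebra is simple if it is nonzero and has no closed two-sided ideals
other than `0` and the whole algebra. -/
def IsSimpleCStar (A : Type*) [CStarAlgebra A] : Prop :=
  Nontrivial A ∧ ∀ I : TwoSidedIdeal A, IsClosed (I : Set A) → I = ⊥ ∨ I = ⊤

/-- Murray-von Neumann equivalence (used for projections `p` and `q`):
there is a partial isometry `v` with `v⋆ v = p` and `v v⋆ = q`. -/
def MvNEquiv (p q : A) : Prop :=
  ∃ v : A, star v * v = p ∧ v * star v = q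

/-- The norm closure of `x A x`. For a positive element `x` this is
the hereditary subalgebra of `A` generated by `x`. -/
def heredSubalg (x : A) : Set A :=
  closure (Set.range fun a : A => x * a * x)

/-- `p` is Murray-von Neumann equivalent to a projection in the hereditary subalgebra
of `A` generated by `x`. -/
def EquivToProjIn (p x : A) : Prop :=
  ∃ q ∈ heredSubalg x, IsStarProjection q ∧ MvNEquiv p q

/-- `v` is a unitary of the corner `e A e`, whose identity is the projection `e`. -/
def IsUnitaryInCorner (e v : A) : Prop :=
  (∃ a : A, v = e * a * e) ∧ star v * v = e ∧ v * star v = e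

end Basic

section Properties

variable {A : Type*} [CStarAlgebra A] [PartialOrder A] [StarOrderedRing A]

/-- The tracial Rokhlin property of an action of a finite group. -/
def TracialRokhlinProperty {G : Type*} [Group G] [Fintype G]
    (α : G →* (A ≃⋆ₐ[ℂ] A)) : Prop :=
  ∀ (F : Finset A) (ε : ℝ), 0 < ε → ∀ x : A, 0 ≤ x → ‖x‖ = 1 →
    ∃ e : G → A,
      (∀ g, IsStarProjection (e g)) ∧
      (∀ g h, g ≠ h → e g * e h = 0) ∧
      (∀ g h, ‖α g (e h) - e (g * h)‖ < ε) ∧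
      (∀ g, ∀ a ∈ F, ‖e g * a - a * e g‖ < ε) ∧
      EquivToProjIn (1 - ∑ g, e g) x ∧
      1 - ε < ‖(∑ g, e g) * x * (∑ g, e g)‖

/-- Tracial approximate representability of an action of a finite abelian group. -/
def TraciallyApproxRepresentable {G : Type*} [CommGroup G] [Finite G]
    (α : G →* (A ≃⋆ₐ[ℂ] A)) : Prop :=
  ∀ (F : Finset A) (ε : ℝ), 0 < ε → ∀ x : A, 0 ≤ x → ‖x‖ = 1 →
    ∃ (e : A) (w : G → A),
      IsStarProjection e ∧
      (∀ g, IsUnitaryInCorner e (w g)) ∧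
      (∀ a ∈ F, ‖e * a - a * e‖ < ε) ∧
      (∀ a ∈ F, ∀ g, ‖α g (e * a * e) - w g * (e * a * e) * star (w g)‖ < ε) ∧
      (∀ g h, ‖w g * w h - w (g * h)‖ < ε) ∧
      (∀ g h, ‖α g (w h) - w h‖ < ε) ∧
      EquivToProjIn (1 - e) x ∧
      1 - ε < ‖e * x * e‖

/-- Strong tracial approximate innerness of an automorphism. -/
def StronglyTraciallyApproxInner (α : A ≃⋆ₐ[ℂ] A) : Prop :=
  ∀ (F : Finset A) (ε : ℝ), 0 < ε → ∀ x : A, 0 ≤ x → ‖x‖ = 1 →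
    ∃ e v : A,
      IsStarProjection e ∧
      IsUnitaryInCorner e v ∧
      ‖α e - e‖ < ε ∧
      (∀ a ∈ F, ‖e * a - a * e‖ < ε) ∧
      (∀ a ∈ F, ‖v * (e * a * e) * star v - α (e * a * e)‖ < ε) ∧
      EquivToProjIn (1 - e) x ∧
      1 - ε < ‖e * x * e‖

end Properties

/-- The action of `ℤ/nℤ` generated by an automorphism `α` with `α ^ n = id`:
the class of `k` acts as `α ^ k`. -/
def cyclicAction {A : Type*} [CStarAlgebra A] (n : ℕ) [NeZero n] (α : A ≃⋆ₐ[ℂ] A)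
    (hα : α ^ n = 1) : Multiplicative (ZMod n) →* (A ≃⋆ₐ[ℂ] A) where
  toFun k := α ^ (ZMod.val k.toAdd)
  map_one' := by simp
  map_mul' a b := by
    rw [toAdd_mul, ZMod.val_add, ← pow_add]
    exact (pow_eq_pow_mod _ hα).symm

end TracialActions

/-! Pass to bounded sequences in `A` modulo null sequences, where approximate relations become
exact. Only the star-ring structure of this quotient is used, so the core of the argument is pure
algebra. Choose a Rokhlin tower `e`; then a projection `g` commuting with `F` and `e`, and a unitary
`v` of its corner implementing `α` on `F` and `e`; then a second Rokhlin tower `f` commuting with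
`F`, `e`, `g` and every `α^k(v)`.

The average `u = ∑ α^k(v) e_k` is `α`-invariant, satisfies `u a = α(a) u` for `a` in `F` (enlarged
to be `α`-invariant), and is a unitary of the corner of `E g`, where `E = ∑ e_k`. Its `n`-th power
need not be the unit. The second tower repairs this: the projections `P_l = ∑_j e_j f_{j+l} g` are
`α`-invariant and orthogonal, and `u` carries `P_{l+1}` to `P_l`, because it advances `e` and
commutes with `f`. Replace `u` on `P_0` by `(u⋆)^(n-1)`. Going once round the cycle now cancels, so
the new `W` has `W^n = q = ∑ P_l`, and it still implements `α`, since `α^(-(n-1)) = α`. This is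
`exists_cyclic_unitary`. Lifting `q` and `W` to projections and corner unitaries of `A`, the powers
of `W` give the required `w_k`.

For the size of `1 - q`, put `Q = ∑ f_k` and split `1 - E g Q g E` as `(1-E) + E(1-g)E + Eg(1-Q)gE`.
The three terms are controlled by orthogonal positive elements of `xA`, which exist because `A` is
simple and infinite dimensional (`exists_three_orthogonal`, `exists_sum_comparison`). The hypotheses
tie size and norm to the same element; `exists_control` separates the two, so that the norm of `x`
can be followed through three successive compressions. -/

namespace TracialActions

/-! ### Comparison of projections through closed right ideals -/

section RightIdeal

variable {A : Type*} [CStarAlgebra A]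

/-- The closed right ideal generated by `y`. -/
def closedRightIdeal (y : A) : Set A :=
  closure (Set.range fun a : A => y * a)

lemma mul_mem_closedRightIdeal (y a : A) : y * a ∈ closedRightIdeal y :=
  subset_closure ⟨a, rfl⟩

lemma closedRightIdeal_mul_mem {y v : A} (hv : v ∈ closedRightIdeal y) (b : A) :
    v * b ∈ closedRightIdeal y := by
  refine map_mem_closure (f := fun v : A => v * b) (by fun_prop) hv ?_
  rintro _ ⟨a, rfl⟩
  exact ⟨a * b, by simp [mul_assoc]⟩

lemma closedRightIdeal_add_mem {y u v : A} (hu : u ∈ closedRightIdeal y)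
    (hv : v ∈ closedRightIdeal y) : u + v ∈ closedRightIdeal y := by
  refine map_mem_closure₂ (f := fun u v : A => u + v) (by fun_prop) hu hv ?_
  rintro _ ⟨a, rfl⟩ _ ⟨b, rfl⟩
  exact ⟨a + b, by simp [mul_add]⟩

lemma closedRightIdeal_subset {y z : A} (hz : z ∈ closedRightIdeal y) :
    closedRightIdeal z ⊆ closedRightIdeal y := by
  refine closure_minimal ?_ isClosed_closure
  rintro _ ⟨a, rfl⟩
  exact closedRightIdeal_mul_mem hz a

lemma heredSubalg_subset (y : A) : heredSubalg y ⊆ closedRightIdeal y := by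
  refine closure_mono ?_
  rintro _ ⟨a, rfl⟩
  exact ⟨a * y, by simp [mul_assoc]⟩

/-- Kills the cross terms when comparisons with orthogonal elements are added. Right ideals, unlike
hereditary subalgebras, are stable under the right multiplications that occur there. -/
lemma star_mul_eq_zero_of_orthogonal {y z u v : A} (hyz : star y * z = 0)
    (hu : u ∈ closedRightIdeal y) (hv : v ∈ closedRightIdeal z) : star u * v = 0 := by
  have := map_mem_closure₂ (f := fun u v : A => star u * v) (u := {0}) (by fun_prop) hu hv ?_
  · simpa using this
  · rintro _ ⟨a, rfl⟩ _ ⟨b, rfl⟩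
    have : star a * star y * (z * b) = star a * (star y * z) * b := by noncomm_ring
    simp [this, hyz]

lemma mul_star_mem_heredSubalg {y v : A} (hy : IsSelfAdjoint y)
    (hv : v ∈ closedRightIdeal y) : v * star v ∈ heredSubalg y := by
  refine map_mem_closure (f := fun v : A => v * star v) (by fun_prop) hv ?_
  rintro _ ⟨a, rfl⟩
  exact ⟨a * star a, by simp [mul_assoc, hy.star_eq]⟩

lemma mul_eq_self_of_star_mul_eq {p v : A} (hp : IsStarProjection p) (hv : star v * v = p) :
    v * p = v := by
  have hpp : p * p = p := hp.isIdempotentElem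
  have hps : star p = p := hp.isSelfAdjoint
  have : star (v * p - v) * (v * p - v) = 0 := by
    have : star (v * p - v) * (v * p - v)
        = p * (star v * v) * p - p * (star v * v) - (star v * v) * p + star v * v := by
      simp only [star_sub, star_mul, hps]; noncomm_ring
    rw [this, hv]; simp [hpp]
  exact sub_eq_zero.mp (CStarRing.star_mul_self_eq_zero_iff _ |>.mp this)

/-- Comparison with a hereditary subalgebra, expressed through the closed right ideal. -/
lemma equivToProjIn_iff {p y : A} (hp : IsStarProjection p) (hy : IsSelfAdjoint y) :
    EquivToProjIn p y ↔ ∃ v ∈ closedRightIdeal y, star v * v = p := by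
  constructor
  · rintro ⟨q, hq, hqp, v, hv, hvq⟩
    refine ⟨v, ?_, hv⟩
    have h1 := mul_eq_self_of_star_mul_eq hp hv
    -- Here `v = v v⋆ v = q v`.
    rw [← h1, ← hv, ← mul_assoc, hvq]
    exact closedRightIdeal_mul_mem (heredSubalg_subset y hq) v
  · rintro ⟨v, hv, hvp⟩
    refine ⟨v * star v, mul_star_mem_heredSubalg hy hv, ?_, v, hvp, rfl⟩
    refine ⟨?_, IsSelfAdjoint.mul_star_self v⟩
    have h1 := mul_eq_self_of_star_mul_eq hp hvp
    change v * star v * (v * star v) = _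
    rw [mul_assoc, ← mul_assoc (star v), hvp, ← mul_assoc, h1]

lemma isStarProjection_sum {ι : Type*} [Fintype ι] {e : ι → A}
    (he : ∀ i, IsStarProjection (e i)) (ho : ∀ i j, i ≠ j → e i * e j = 0) :
    IsStarProjection (∑ i, e i) := by
  classical
  refine ⟨?_, ?_⟩
  · change (∑ i, e i) * (∑ i, e i) = ∑ i, e i
    rw [Finset.sum_mul_sum]
    refine Finset.sum_congr rfl fun i _ => ?_
    rw [Finset.sum_eq_single i (fun j _ hj => ho i j hj.symm) (by simp)]
    exact (he i).isIdempotentElem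
  · exact isSelfAdjoint_sum _ fun i _ => (he i).isSelfAdjoint

end RightIdeal

/-! ### Primeness and a finite-dimensionality criterion for simple algebras -/

section Simple

variable {A : Type*} [CStarAlgebra A]

/-- The elements `a` with `x A a = 0` form a closed two-sided ideal; it omits `1` as `x ≠ 0`, so it
is zero. -/
lemma IsSimpleCStar.exists_mul_mul_ne_zero (hA : IsSimpleCStar A) {x y : A} (hx : x ≠ 0)
    (hy : y ≠ 0) : ∃ b, x * b * y ≠ 0 := by
  by_contra! h
  let I : TwoSidedIdeal A := TwoSidedIdeal.mk' {a | ∀ b, x * b * a = 0} (by simp)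
    (fun {a c} ha hc b => by simp [mul_add, ha b, hc b]) (fun {a} ha b => by simp [ha b])
    (fun {a c} hc b => by rw [← mul_assoc, mul_assoc x, hc])
    (fun {a c} ha b => by rw [← mul_assoc, ha, zero_mul])
  have hI : ∀ a, a ∈ I ↔ ∀ b, x * b * a = 0 := fun a => by
    simp only [I, TwoSidedIdeal.mem_mk']; rfl
  have hc : IsClosed (I : Set A) := by
    have : (I : Set A) = ⋂ b : A, {a | x * b * a = 0} := by
      ext a; simp [hI]
    rw [this]
    exact isClosed_iInter fun b => isClosed_eq (by fun_prop) (by fun_prop)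
  rcases hA.2 I hc with h0 | h1
  · have : y ∈ I := (hI y).2 h
    rw [h0] at this
    exact hy (by simpa using this)
  · have : (1 : A) ∈ I := by rw [h1]; trivial
    exact hx (by simpa using (hI 1).1 this 1)

/-- In a simple C⋆-algebra, the algebraic span of `A x A` is everything. -/
lemma IsSimpleCStar.one_mem_span (hA : IsSimpleCStar A) {x : A} (hx : x ≠ 0) :
    (1 : A) ∈ Submodule.span ℂ (Set.range fun p : A × A => p.1 * x * p.2) := by
  set S := Submodule.span ℂ (Set.range fun p : A × A => p.1 * x * p.2) with hS
  have hl : ∀ a s, s ∈ S → a * s ∈ S := by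
    intro a s hs
    have : S ≤ S.comap (LinearMap.mulLeft ℂ a) := by
      refine Submodule.span_le.2 ?_
      rintro _ ⟨⟨b, c⟩, rfl⟩
      exact Submodule.subset_span ⟨(a * b, c), by simp [mul_assoc]⟩
    exact this hs
  have hr : ∀ a s, s ∈ S → s * a ∈ S := by
    intro a s hs
    have : S ≤ S.comap (LinearMap.mulRight ℂ a) := by
      refine Submodule.span_le.2 ?_
      rintro _ ⟨⟨b, c⟩, rfl⟩
      exact Submodule.subset_span ⟨(b, c * a), by simp [mul_assoc]⟩
    exact this hs
  let I : TwoSidedIdeal A := TwoSidedIdeal.mk' (closure (S : Set A))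
    (S.topologicalClosure.zero_mem)
    (fun ha hc => S.topologicalClosure.add_mem ha hc)
    (fun ha => S.topologicalClosure.neg_mem ha)
    (fun {a c} hc => map_mem_closure (f := fun s : A => a * s) (by fun_prop) hc
      fun s hs => hl a s hs)
    (fun {a c} hc => map_mem_closure (f := fun s : A => s * c) (by fun_prop) hc
      fun s hs => hr c s hs)
  have hI : (I : Set A) = closure (S : Set A) :=
    TwoSidedIdeal.coe_mk' _ _ _ _ _ _
  rcases hA.2 I (by rw [hI]; exact isClosed_closure) with h0 | h1
  · have : x ∈ (I : Set A) := by
      rw [hI]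
      exact subset_closure (Submodule.subset_span ⟨(1, 1), by simp⟩)
    rw [h0] at this
    exact absurd (by simpa using this) hx
  · have : (1 : A) ∈ closure (S : Set A) := by rw [← hI, h1]; trivial
    -- An element of the span at distance less than `1` from the unit is invertible, so no closure
    -- is needed.
    obtain ⟨s, hs, hd⟩ := Metric.mem_closure_iff.1 this 1 one_pos
    have hu : IsUnit s := by
      rw [dist_eq_norm] at hd
      simpa using isUnit_one_sub_of_norm_lt_one hd
    obtain ⟨u, rfl⟩ := hu
    simpa using hr (↑u⁻¹) _ hs

/-- Write `1` as a finite combination of products `a x b`. Expanding both units in `c = 1 c 1` gives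
terms `a (x b c a' x) b'`, each a scalar multiple of `a x b'`, and there are finitely many of these.
-/
lemma IsSimpleCStar.finiteDimensional (hA : IsSimpleCStar A) {x : A} (hx : x ≠ 0)
    (h : ∀ c, ∃ t : ℂ, x * c * x = t • x) : FiniteDimensional ℂ A := by
  obtain ⟨T, hT, h1⟩ := Submodule.mem_span_finite_of_mem_span (hA.one_mem_span hx)
  choose f hf using fun t : T => hT t.2
  let U : Submodule ℂ A := Submodule.span ℂ
    (Set.range fun p : T × T => (f p.1).1 * x * (f p.2).2)
  have h2 : ∀ c, ∀ u ∈ Submodule.span ℂ (T : Set A), ∀ v ∈ Submodule.span ℂ (T : Set A),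
      u * c * v ∈ U := by
    intro c u hu v hv
    induction hu, hv using Submodule.span_induction₂ with
    | mem_mem s t hs ht =>
      obtain ⟨r, hr⟩ := h ((f ⟨s, hs⟩).2 * c * (f ⟨t, ht⟩).1)
      have e1 := hf ⟨s, hs⟩
      have e2 := hf ⟨t, ht⟩
      simp only at e1 e2
      have : s * c * t = r • ((f ⟨s, hs⟩).1 * x * (f ⟨t, ht⟩).2) := by
        calc s * c * t = ((f ⟨s, hs⟩).1 * x * (f ⟨s, hs⟩).2) * c *
              ((f ⟨t, ht⟩).1 * x * (f ⟨t, ht⟩).2) := by rw [e1, e2]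
          _ = (f ⟨s, hs⟩).1 * (x * ((f ⟨s, hs⟩).2 * c * (f ⟨t, ht⟩).1) * x)
              * (f ⟨t, ht⟩).2 := by noncomm_ring
          _ = _ := by rw [hr]; simp
      rw [this]
      exact U.smul_mem _ (Submodule.subset_span ⟨(⟨s, hs⟩, ⟨t, ht⟩), rfl⟩)
    | zero_left y _ => simp
    | zero_right y _ => simp
    | add_left a b c' _ _ _ h1 h2 => rw [add_mul, add_mul]; exact U.add_mem h1 h2
    | add_right a b c' _ _ _ h1 h2 => rw [mul_add]; exact U.add_mem h1 h2
    | smul_left r a b _ _ h1 => rw [smul_mul_assoc, smul_mul_assoc]; exact U.smul_mem r h1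
    | smul_right r a b _ _ h1 => rw [mul_smul_comm]; exact U.smul_mem r h1
  have hU : U = ⊤ := by
    rw [eq_top_iff]
    intro c _
    simpa using h2 c 1 h1 1 h1
  refine Module.Finite.of_fg_top (R := ℂ) (M := A) ?_
  rw [← hU]
  exact Submodule.fg_span (Set.finite_range _)

end Simple

/-! ### Orthogonal positive elements in `xA` -/

section Orthogonal

variable {A : Type*} [CStarAlgebra A] [PartialOrder A] [StarOrderedRing A]

/-- Take the squares of the positive and negative parts of `y`. Squaring puts them visibly in `xA`,
since `y⁺ y⁺ = y y⁺`. -/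
lemma exists_orthogonal_of_not_comparable {x y : A} (hy : IsSelfAdjoint y)
    (hyx : ∃ b, y = x * b) (h1 : ¬ 0 ≤ y) (h2 : ¬ y ≤ 0) :
    ∃ y₁ y₂ : A, 0 ≤ y₁ ∧ 0 ≤ y₂ ∧ y₁ ≠ 0 ∧ y₂ ≠ 0 ∧ y₁ * y₂ = 0 ∧
      (∃ b, y₁ = x * b) ∧ ∃ b, y₂ = x * b := by
  obtain ⟨b, hb⟩ := hyx
  have hp : 0 ≤ y⁺ := CFC.posPart_nonneg y
  have hn : 0 ≤ y⁻ := CFC.negPart_nonneg y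
  have hpn : y⁺ * y⁻ = 0 := CFC.posPart_mul_negPart y
  have hnp : y⁻ * y⁺ = 0 := CFC.negPart_mul_posPart y
  have hs : y⁺ - y⁻ = y := CFC.posPart_sub_negPart y hy
  have sq0 : ∀ a : A, 0 ≤ a → a * a = 0 → a = 0 := fun a ha h => by
    have := (CStarRing.star_mul_self_eq_zero_iff a).1 (by rw [ha.isSelfAdjoint.star_eq, h])
    exact this
  refine ⟨y⁺ * y⁺, y⁻ * y⁻, ?_, ?_, ?_, ?_, ?_, ⟨b * y⁺, ?_⟩, ⟨-(b * y⁻), ?_⟩⟩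
  · simpa [hp.isSelfAdjoint.star_eq] using star_mul_self_nonneg (y⁺)
  · simpa [hn.isSelfAdjoint.star_eq] using star_mul_self_nonneg (y⁻)
  · intro h
    have := sq0 _ hp h
    exact h2 (by rw [← hs, this]; simpa using hn)
  · intro h
    have := sq0 _ hn h
    exact h1 (by rw [← hs, this]; simpa using hp)
  · rw [mul_assoc, ← mul_assoc (y⁺) (y⁻), hpn]; simp
  · rw [← mul_assoc, ← hb]; nth_rw 3 [← hs]; rw [sub_mul, hnp]; simp
  · rw [mul_neg, ← mul_assoc, ← hb]; nth_rw 3 [← hs]; rw [sub_mul, hpn]; simp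

/-- Every nonzero positive element of a simple infinite-dimensional C⋆-algebra dominates two
nonzero orthogonal positive elements, in the sense of right ideals. -/
lemma IsSimpleCStar.exists_orthogonal (hA : IsSimpleCStar A) (hinf : ¬ FiniteDimensional ℂ A)
    {x : A} (hx : 0 ≤ x) (hx0 : x ≠ 0) :
    ∃ y₁ y₂ : A, 0 ≤ y₁ ∧ 0 ≤ y₂ ∧ y₁ ≠ 0 ∧ y₂ ≠ 0 ∧ y₁ * y₂ = 0 ∧
      (∃ b, y₁ = x * b) ∧ ∃ b, y₂ = x * b := by
  by_contra hno
  have hsx : star x = x := hx.isSelfAdjoint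
  have hx2 : 0 ≤ x * x := by simpa [hsx] using star_mul_self_nonneg x
  have hx20 : x * x ≠ 0 := fun h => hx0 <|
    (CStarRing.star_mul_self_eq_zero_iff x).1 (by rw [hsx, h])
  -- Without orthogonal pairs, every selfadjoint element of `xAx` has a sign.
  have cmp : ∀ c : A, IsSelfAdjoint c → 0 ≤ x * c * x ∨ x * c * x ≤ 0 := by
    intro c hc
    by_contra! h
    refine hno (exists_orthogonal_of_not_comparable ?_ ⟨c * x, by rw [mul_assoc]⟩ h.1 h.2)
    simp [IsSelfAdjoint, hsx, hc.star_eq, mul_assoc]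
  have key : ∀ c : A, 0 ≤ c → ∃ t : ℝ, x * c * x = t • (x * x) := by
    intro c hc
    let φ : ℝ → A := fun t => x * c * x - t • (x * x)
    have hφ : Continuous φ := by fun_prop
    have hφ' : ∀ t, φ t = x * (c - t • (1 : A)) * x := fun t => by
      simp [φ, mul_sub, sub_mul]
    -- Two nonempty closed sets cover the connected real line, so they meet; at a common point `φ`
    -- vanishes.
    have hcov : (Set.univ : Set ℝ) ⊆ {t | 0 ≤ φ t} ∪ {t | φ t ≤ 0} := fun t _ => by
      have := cmp (c - t • (1 : A)) (hc.isSelfAdjoint.sub ((IsSelfAdjoint.all t).smul (.one A)))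
      rw [← hφ'] at this
      exact this
    have hP : IsClosed {t | 0 ≤ φ t} := isClosed_Ici.preimage hφ
    have hN : IsClosed {t | φ t ≤ 0} := isClosed_Iic.preimage hφ
    have h0 : (0 : ℝ) ∈ {t | 0 ≤ φ t} := by
      simpa [φ, hsx] using star_left_conjugate_nonneg hc x
    have h1 : ‖c‖ ∈ {t | φ t ≤ 0} := by
      have hle : c - ‖c‖ • (1 : A) ≤ 0 := by
        rw [sub_nonpos, ← Algebra.algebraMap_eq_smul_one]
        exact hc.isSelfAdjoint.le_algebraMap_norm_self
      have := star_left_conjugate_le_conjugate hle x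
      simpa [hφ', hsx] using this
    obtain ⟨t, -, ht1, ht2⟩ := isPreconnected_closed_iff.1 isPreconnected_univ _ _ hP hN hcov
      ⟨0, trivial, h0⟩ ⟨_, trivial, h1⟩
    exact ⟨t, sub_eq_zero.1 (le_antisymm ht2 ht1)⟩
  -- The criterion is applied to `x²`: for positive `c`, `x² c x² = x (x c x) x` is a multiple of
  -- `x²`, and positive elements span.
  refine hinf (hA.finiteDimensional hx20 fun c => ?_)
  have hc : c ∈ Submodule.span ℂ {a : A | 0 ≤ a} := by
    rw [CStarAlgebra.span_nonneg]; trivial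
  induction hc using Submodule.span_induction with
  | mem c hc =>
    have hxc : 0 ≤ x * c * x := by simpa [hsx] using star_left_conjugate_nonneg hc x
    obtain ⟨t, ht⟩ := key _ hxc
    exact ⟨t, by rw [Complex.coe_smul, ← ht]; noncomm_ring⟩
  | zero => exact ⟨0, by simp⟩
  | add a b _ _ ha hb =>
    obtain ⟨s, hs⟩ := ha
    obtain ⟨t, ht⟩ := hb
    exact ⟨s + t, by rw [mul_add, add_mul, hs, ht, add_smul]⟩
  | smul r a _ ha =>
    obtain ⟨s, hs⟩ := ha
    exact ⟨r * s, by rw [mul_smul_comm, smul_mul_assoc, hs, smul_smul]⟩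

lemma IsSimpleCStar.exists_three_orthogonal (hA : IsSimpleCStar A)
    (hinf : ¬ FiniteDimensional ℂ A) {x : A} (hx : 0 ≤ x) (hx0 : x ≠ 0) :
    ∃ y₁ y₂ y₃ : A, 0 ≤ y₁ ∧ 0 ≤ y₂ ∧ 0 ≤ y₃ ∧ y₁ ≠ 0 ∧ y₂ ≠ 0 ∧ y₃ ≠ 0 ∧
      y₁ * y₂ = 0 ∧ y₁ * y₃ = 0 ∧ y₂ * y₃ = 0 ∧
      (∃ b, y₁ = x * b) ∧ (∃ b, y₂ = x * b) ∧ ∃ b, y₃ = x * b := by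
  obtain ⟨y₁, z, h1, hz, h10, hz0, h1z, hx1, b, hb⟩ := hA.exists_orthogonal hinf hx hx0
  obtain ⟨y₂, y₃, h2, h3, h20, h30, h23, ⟨c, hc⟩, d, hd⟩ := hA.exists_orthogonal hinf hz hz0
  refine ⟨y₁, y₂, y₃, h1, h2, h3, h10, h20, h30, ?_, ?_, h23, hx1, ⟨b * c, ?_⟩, b * d, ?_⟩
  · rw [hc, ← mul_assoc, h1z, zero_mul]
  · rw [hd, ← mul_assoc, h1z, zero_mul]
  · rw [hc, hb, mul_assoc]
  · rw [hd, hb, mul_assoc]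

end Orthogonal

/-! ### Separating the norm condition from the size condition -/

section Compare

variable {A : Type*} [CStarAlgebra A] [PartialOrder A] [StarOrderedRing A]

/-- If `v` lies in the closed right ideal of `z z⋆`, then `v⋆ v = u⋆ u` for some `u` in the closed
right ideal of `z⋆`. -/
lemma exists_closedRightIdeal_star {z v : A} (hv : v ∈ closedRightIdeal (z * star z)) :
    ∃ u ∈ closedRightIdeal (star z), star u * u = star v * v := by
  obtain ⟨w, hw, hlim⟩ := mem_closure_iff_seq_limit.1 hv
  choose a ha using hw
  set s := CFC.sqrt (z * star z) with hs
  -- With `s = (z z⋆)^(1/2)`, the map `z z⋆ c ↦ z⋆ s c` preserves inner products, both being `c⋆ s⁴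
  -- d`. It therefore extends to closures, replacing a polar decomposition.
  have hzz : 0 ≤ z * star z := mul_star_self_nonneg z
  have hss : s * s = z * star z := CFC.sqrt_mul_sqrt_self _
  have hsa : star s = s := (CFC.sqrt_nonneg (z * star z)).isSelfAdjoint
  have key : ∀ c d : A, star (star z * s * c) * (star z * s * d)
      = star (z * star z * c) * (z * star z * d) := fun c d => by
    rw [← hss]
    simp only [star_mul, hsa, star_star, mul_assoc]
    rw [← mul_assoc z, ← hss]
    simp only [mul_assoc]
  have hnorm : ∀ c, ‖star z * s * c‖ = ‖z * star z * c‖ := fun c => by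
    rw [← sq_eq_sq₀ (norm_nonneg _) (norm_nonneg _), sq, sq, ← CStarRing.norm_star_mul_self,
      ← CStarRing.norm_star_mul_self, key]
  have hcau : CauchySeq fun m => star z * s * a m := by
    have hc := hlim.cauchySeq
    rw [Metric.cauchySeq_iff] at hc ⊢
    intro ε hε
    obtain ⟨N, hN⟩ := hc ε hε
    refine ⟨N, fun m hm k hk => ?_⟩
    have := hN m hm k hk
    rw [dist_eq_norm, ← ha, ← ha] at this
    rw [dist_eq_norm, ← mul_sub, hnorm, mul_sub]
    exact this
  obtain ⟨u, hu⟩ := cauchySeq_tendsto_of_complete hcau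
  refine ⟨u, mem_closure_of_tendsto hu (.of_forall fun m => ⟨s * a m, by simp [mul_assoc]⟩), ?_⟩
  refine tendsto_nhds_unique (hu.star.mul hu) ?_
  convert hlim.star.mul hlim using 2 with m
  rw [key, ← ha]

/-- Separates the roles of the element controlling the norm and the one controlling the size. -/
lemma IsSimpleCStar.exists_control (hA : IsSimpleCStar A) {x y : A} (hx : 0 ≤ x)
    (hx1 : ‖x‖ = 1) (hy : 0 ≤ y) (hy0 : y ≠ 0) {δ : ℝ} (hδ : 0 < δ) (hδ1 : δ < 1) :
    ∃ x₁ : A, 0 ≤ x₁ ∧ ‖x₁‖ = 1 ∧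
      (∀ p, IsStarProjection p → EquivToProjIn p x₁ → EquivToProjIn p y) ∧
      ∀ e, IsStarProjection e → (1 - δ) * ‖e * x₁ * e‖ ≤ ‖e * x * e‖ := by
  have hδ' : 0 < 1 - δ := by linarith
  -- `f` lives above `1 - δ`, where `h = 1`, so `h f = f`. On the spectrum of `x`, `h(t)² ≤ t / (1 -
  -- δ)`.
  let f : ℝ → ℝ := fun t => max (t - (1 - δ)) 0
  let h : ℝ → ℝ := fun t => min 1 (max t 0 / (1 - δ))
  have hf : Continuous f := by fun_prop
  have hh : Continuous h := by fun_prop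
  have hxs := hx.isSelfAdjoint
  have hnt : Nontrivial A := hA.1
  have hhf : cfc h x * cfc f x = cfc f x := by
    rw [← cfc_mul h f x hh.continuousOn hf.continuousOn]
    refine cfc_congr fun t _ => ?_
    simp only [h, f]
    rcases le_total t (1 - δ) with ht | ht
    · rw [max_eq_right (by linarith : t - (1 - δ) ≤ 0)]; simp
    · rw [min_eq_left, one_mul]
      rw [le_div_iff₀ hδ', max_eq_left (by linarith)]; linarith
  have hfs : star (cfc f x) = cfc f x := (cfc_predicate f x :)
  have hhs : star (cfc h x) = cfc h x := (cfc_predicate h x :)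
  have hf0 : cfc f x ≠ 0 := by
    intro h0
    have hsp : (1 : ℝ) ∈ spectrum ℝ x := by
      rw [← hx1]; exact CStarAlgebra.norm_mem_spectrum_of_nonneg hx
    have h1 : f 1 ∈ spectrum ℝ (cfc f x) := by
      rw [cfc_map_spectrum f x hxs hf.continuousOn]
      exact ⟨1, hsp, rfl⟩
    rw [h0, spectrum.zero_eq] at h1
    have : f 1 = δ := by simp [f, hδ.le]
    rw [this] at h1
    exact hδ.ne' h1
  have hhh : cfc h x * cfc h x ≤ (1 - δ)⁻¹ • x := by
    have : (1 - δ)⁻¹ • x = cfc (fun t : ℝ => (1 - δ)⁻¹ * t) x := by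
      rw [cfc_const_mul _ _ x, cfc_id' ℝ x]
    rw [this, ← cfc_mul h h x hh.continuousOn hh.continuousOn]
    refine cfc_mono (fun t ht => ?_) (by fun_prop) (by fun_prop)
    have ht0 : 0 ≤ t := spectrum_nonneg_of_nonneg hx ht
    simp only [h, max_eq_left ht0]
    have h1 : min 1 (t / (1 - δ)) ≤ 1 := min_le_left _ _
    have h2 : min 1 (t / (1 - δ)) ≤ t / (1 - δ) := min_le_right _ _
    have h3 : 0 ≤ min 1 (t / (1 - δ)) := le_min zero_le_one (by positivity)
    rw [inv_mul_eq_div]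
    nlinarith
  -- Primeness links the two elements: `z = f(x) b y` is nonzero, `h(x)` acts as a unit on `z z⋆`,
  -- and `z⋆` lies in `yA`.
  obtain ⟨b, hb⟩ := hA.exists_mul_mul_ne_zero hf0 hy0
  set z := cfc f x * b * y with hz
  have hzz0 : z * star z ≠ 0 := fun h => hb ((CStarRing.mul_star_self_eq_zero_iff z).1 h)
  have hn : 0 < ‖z * star z‖ := norm_pos_iff.2 hzz0
  set x₁ := ‖z * star z‖⁻¹ • (z * star z) with hx₁
  have h0 : 0 ≤ x₁ := smul_nonneg (by positivity) (mul_star_self_nonneg z)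
  have hn1 : ‖x₁‖ = 1 := by
    rw [hx₁, norm_smul, norm_inv, norm_norm, inv_mul_cancel₀ hn.ne']
  refine ⟨x₁, h0, hn1, fun p hp hpx => ?_, fun e he => ?_⟩
  · rw [equivToProjIn_iff hp h0.isSelfAdjoint] at hpx
    rw [equivToProjIn_iff hp hy.isSelfAdjoint]
    obtain ⟨v, hv, hvp⟩ := hpx
    have hv' : v ∈ closedRightIdeal (z * star z) := by
      refine closedRightIdeal_subset ?_ hv
      have := mul_mem_closedRightIdeal (z * star z) (‖z * star z‖⁻¹ • (1 : A))
      rwa [mul_smul_comm, mul_one] at this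
    obtain ⟨u, hu, huv⟩ := exists_closedRightIdeal_star hv'
    have hzy : star z ∈ closedRightIdeal y := by
      rw [hz, star_mul, hy.isSelfAdjoint.star_eq]
      exact mul_mem_closedRightIdeal y _
    exact ⟨u, closedRightIdeal_subset hzy hu, huv.trans hvp⟩
  · have hhz : cfc h x * z = z := by rw [hz, ← mul_assoc, ← mul_assoc, hhf]
    have hzh : star z * cfc h x = star z := by
      have := congrArg star hhz
      simpa [hhs] using this
    have hx₁h : cfc h x * x₁ * cfc h x = x₁ := by
      rw [hx₁, mul_smul_comm, smul_mul_assoc, ← mul_assoc (cfc h x), hhz, mul_assoc z, hzh]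
    have hle1 : x₁ ≤ 1 := (CStarAlgebra.norm_le_one_iff_of_nonneg x₁ h0).1 hn1.le
    have hle : x₁ ≤ (1 - δ)⁻¹ • x := by
      refine le_trans ?_ hhh
      have := star_left_conjugate_le_conjugate hle1 (cfc h x)
      rwa [hhs, hx₁h, mul_one] at this
    have hes : star e = e := he.isSelfAdjoint
    have hle2 : e * x₁ * e ≤ (1 - δ)⁻¹ • (e * x * e) := by
      have := star_left_conjugate_le_conjugate hle e
      rwa [hes, mul_smul_comm ((1 - δ)⁻¹), smul_mul_assoc ((1 - δ)⁻¹)] at this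
    have h3 : 0 ≤ e * x₁ * e := by simpa [hes] using star_left_conjugate_nonneg h0 e
    have h4 := CStarAlgebra.norm_le_norm_of_nonneg_of_le h3 hle2
    rw [norm_smul, norm_inv, Real.norm_of_nonneg hδ'.le, ← div_eq_inv_mul,
      le_div_iff₀ hδ'] at h4
    linarith

/-- Allows the hypotheses to be applied to compressions of `x`, which need not have norm one. -/
lemma exists_normalized {x : A} (hx : 0 ≤ x) (hx0 : x ≠ 0) :
    ∃ x' : A, 0 ≤ x' ∧ ‖x'‖ = 1 ∧
      ∀ (e : A) (c : ℝ), c < ‖e * x' * e‖ → c * ‖x‖ < ‖e * x * e‖ := by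
  have hn : 0 < ‖x‖ := norm_pos_iff.2 hx0
  refine ⟨‖x‖⁻¹ • x, smul_nonneg (by positivity) hx, ?_, fun e c h => ?_⟩
  · rw [norm_smul, norm_inv, norm_norm, inv_mul_cancel₀ hn.ne']
  · rw [mul_smul_comm, smul_mul_assoc, norm_smul, norm_inv, norm_norm, ← div_eq_inv_mul,
      lt_div_iff₀ hn] at h
    exact h

/-- The tracial Rokhlin property with independent norm and comparison conditions. -/
lemma TracialRokhlinProperty.exists_towers {G : Type*} [Group G] [Fintype G]
    {α : G →* (A ≃⋆ₐ[ℂ] A)} (h : TracialRokhlinProperty α) (hA : IsSimpleCStar A)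
    (F : Finset A) {δ : ℝ} (hδ : 0 < δ) (hδ1 : δ < 1) {x y : A} (hx : 0 ≤ x) (hx0 : x ≠ 0)
    (hy : 0 ≤ y) (hy0 : y ≠ 0) :
    ∃ e : G → A,
      (∀ g, IsStarProjection (e g)) ∧
      (∀ g h, g ≠ h → e g * e h = 0) ∧
      (∀ g h, ‖α g (e h) - e (g * h)‖ < δ) ∧
      (∀ g, ∀ a ∈ F, ‖e g * a - a * e g‖ < δ) ∧
      EquivToProjIn (1 - ∑ g, e g) y ∧
      (1 - δ) ^ 2 * ‖x‖ < ‖(∑ g, e g) * x * (∑ g, e g)‖ := by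
  obtain ⟨x', hx', hxn, hx'e⟩ := exists_normalized hx hx0
  obtain ⟨x₁, h0, h1, hp, hn⟩ := hA.exists_control hx' hxn hy hy0 hδ hδ1
  obtain ⟨e, he, ho, h3, h4, h5, h6⟩ := h F δ hδ x₁ h0 h1
  have hE := isStarProjection_sum he ho
  refine ⟨e, he, ho, h3, h4, hp _ hE.one_sub h5, ?_⟩
  -- One factor `1 - δ` comes from the Rokhlin property, the other from `exists_control`.
  exact hx'e _ _ (lt_of_lt_of_le (by nlinarith) (hn _ hE))

/-- Strong tracial approximate innerness with independent norm and comparison conditions. -/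
lemma StronglyTraciallyApproxInner.exists_unitary {α : A ≃⋆ₐ[ℂ] A}
    (h : StronglyTraciallyApproxInner α) (hA : IsSimpleCStar A)
    (F : Finset A) {δ : ℝ} (hδ : 0 < δ) (hδ1 : δ < 1) {x y : A} (hx : 0 ≤ x) (hx0 : x ≠ 0)
    (hy : 0 ≤ y) (hy0 : y ≠ 0) :
    ∃ e v : A,
      IsStarProjection e ∧
      IsUnitaryInCorner e v ∧
      ‖α e - e‖ < δ ∧
      (∀ a ∈ F, ‖e * a - a * e‖ < δ) ∧
      (∀ a ∈ F, ‖v * (e * a * e) * star v - α (e * a * e)‖ < δ) ∧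
      EquivToProjIn (1 - e) y ∧
      (1 - δ) ^ 2 * ‖x‖ < ‖e * x * e‖ := by
  obtain ⟨x', hx', hxn, hx'e⟩ := exists_normalized hx hx0
  obtain ⟨x₁, h0, h1, hp, hn⟩ := hA.exists_control hx' hxn hy hy0 hδ hδ1
  obtain ⟨e, v, he, hv, h2, h3, h4, h5, h6⟩ := h F δ hδ x₁ h0 h1
  refine ⟨e, v, he, hv, h2, h3, h4, hp _ he.one_sub h5, ?_⟩
  exact hx'e _ _ (lt_of_lt_of_le (by nlinarith) (hn _ he))

end Compare

/-! ### Perturbation of almost projections and almost unitaries -/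

section Perturbation

variable {A : Type*} [CStarAlgebra A]

/-- An almost idempotent selfadjoint element is close to a projection. -/
lemma exists_isStarProjection_near {b : A} (hb : IsSelfAdjoint b) {δ : ℝ} (hδ : δ < 1 / 4)
    (h : ‖b * b - b‖ ≤ δ) : ∃ q : A, IsStarProjection q ∧ ‖q - b‖ ≤ 2 * δ := by
  have hδ0 : 0 ≤ δ := (norm_nonneg _).trans h
  have hsp : ∀ t ∈ spectrum ℝ b, |t * t - t| ≤ δ := by
    intro t ht
    have e : b * b - b = cfc (fun t : ℝ => t * t - t) b := by
      rw [cfc_sub (fun t : ℝ => t * t) (fun t : ℝ => t) b, cfc_mul (fun t : ℝ => t) (fun t : ℝ => t) b, cfc_id' ℝ b]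
    rw [e] at h
    exact (norm_apply_le_norm_cfc (fun t : ℝ => t * t - t) b ht).trans h
  have hhalf : ∀ t ∈ spectrum ℝ b, t ≠ 1 / 2 := by
    rintro t ht rfl
    have := hsp _ ht
    norm_num [abs_le] at this
    linarith
  -- The jump is at `1/2`, which is off the spectrum because `|t² - t| ≤ δ < 1/4` there.
  let f : ℝ → ℝ := fun t => if 1 / 2 < t then 1 else 0
  have hf : ContinuousOn f (spectrum ℝ b) := by
    intro t ht
    refine ContinuousAt.continuousWithinAt ?_
    rcases lt_or_gt_of_ne (hhalf t ht) with h1 | h1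
    · refine (continuousAt_const (y := (0 : ℝ))).congr ?_
      filter_upwards [eventually_lt_nhds h1] with s hs
      exact (if_neg (not_lt.2 hs.le)).symm
    · refine (continuousAt_const (y := (1 : ℝ))).congr ?_
      filter_upwards [eventually_gt_nhds h1] with s hs
      simp only [f, if_pos hs]
  refine ⟨cfc f b, ⟨?_, cfc_predicate f b⟩, ?_⟩
  · change cfc f b * cfc f b = cfc f b
    rw [← cfc_mul f f b hf hf]
    refine cfc_congr fun t _ => ?_
    simp only [f]; split_ifs <;> simp
  · nth_rw 2 [← cfc_id' ℝ b]
    rw [← cfc_sub f (fun t : ℝ => t) b hf]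
    refine norm_cfc_le (by positivity) fun t ht => ?_
    have h1 := hsp t ht
    rw [abs_le] at h1
    rw [Real.norm_eq_abs, abs_le]
    simp only [f]
    split_ifs with h2
    · constructor <;> nlinarith
    · constructor <;> nlinarith

/-- The polar part of an element whose modulus is close to `1`. -/
lemma exists_invSqrt {h : A} (hh : IsSelfAdjoint h) {δ : ℝ} (hδ : δ ≤ 1 / 2)
    (hn : ‖h - 1‖ ≤ δ) :
    ∃ k : A, IsSelfAdjoint k ∧ k * h * k = 1 ∧ ‖k - 1‖ ≤ 2 * δ ∧
      ∀ q, Commute h q → Commute k q := by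
  have hδ0 : 0 ≤ δ := (norm_nonneg _).trans hn
  have hsp : ∀ t ∈ spectrum ℝ h, |t - 1| ≤ δ := by
    intro t ht
    have e : h - 1 = cfc (fun t : ℝ => t - 1) h := by
      rw [cfc_sub (fun t : ℝ => t) (fun _ : ℝ => (1 : ℝ)) h, cfc_id' ℝ h, cfc_const_one ℝ h]
    rw [e] at hn
    exact (norm_apply_le_norm_cfc (fun t : ℝ => t - 1) h ht).trans hn
  have hpos : ∀ t ∈ spectrum ℝ h, 1 / 2 ≤ t := fun t ht => by
    have := (abs_le.1 (hsp t ht)).1; linarith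
  let f : ℝ → ℝ := fun t => (√t)⁻¹
  have hf : ContinuousOn f (spectrum ℝ h) := by
    refine ContinuousOn.inv₀ (by fun_prop) fun t ht => ?_
    exact (Real.sqrt_pos.2 (by linarith [hpos t ht])).ne'
  refine ⟨cfc f h, cfc_predicate f h, ?_, ?_, fun q hq => ?_⟩
  · nth_rw 2 [← cfc_id' ℝ h]
    rw [← cfc_mul f (fun t : ℝ => t) h hf, ← cfc_mul (fun t => f t * t) f h (hf.mul continuousOn_id) hf,
      ← cfc_const_one ℝ h]
    refine cfc_congr fun t ht => ?_
    have h0 : 0 < t := by linarith [hpos t ht]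
    have h1 := Real.sqrt_pos.2 h0
    simp only [f]
    field_simp
    rw [Real.sq_sqrt h0.le]
  · rw [← cfc_const_one ℝ h, ← cfc_sub f (fun _ : ℝ => (1 : ℝ)) h hf]
    refine norm_cfc_le (by positivity) fun t ht => ?_
    have h0 : 0 < t := by linarith [hpos t ht]
    have h1 := Real.sqrt_pos.2 h0
    have h2 := abs_le.1 (hsp t ht)
    have h3 : 1 / 2 ≤ √t := by
      rw [Real.le_sqrt (by norm_num) h0.le]; linarith [hpos t ht]
    have h4 := Real.sq_sqrt h0.le
    rw [Real.norm_eq_abs, abs_le]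
    simp only [f]
    have e : (√t)⁻¹ - 1 = (1 - √t) / √t := by field_simp
    rw [e, le_div_iff₀ h1, div_le_iff₀ h1]
    constructor <;> nlinarith
  · refine Commute.cfc ?_ ?_ f
    · exact hq
    · rw [hh.star_eq]; exact hq

/-- If `s⋆ s` is close to a projection `p`, then `p` is equivalent to a projection in every
hereditary subalgebra whose closed right ideal contains `s`. -/
lemma equivToProjIn_of_near {p s x : A} (hp : IsStarProjection p) (hx : IsSelfAdjoint x)
    (hs : s ∈ closedRightIdeal x) (hn : ‖star s * s - p‖ ≤ 1 / 2) : EquivToProjIn p x := by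
  have hpp : p * p = p := hp.isIdempotentElem
  have hps : star p = p := hp.isSelfAdjoint
  -- The summand `1 - p` makes the compression invertible in `A`. With `k = h^(-1/2)`, which
  -- commutes with `p`, the element `s p k` has `(s p k)⋆ (s p k) = p`.
  set h := p * (star s * s) * p + (1 - p) with hh
  have hsa : IsSelfAdjoint h := by
    simp [IsSelfAdjoint, hh, hps, mul_assoc]
  have hle : ‖h - 1‖ ≤ 1 / 2 := by
    have : h - 1 = p * (star s * s - p) * p := by
      simp only [hh, mul_sub, sub_mul, hpp]; abel
    rw [this]
    have hp1 : ‖p‖ ≤ 1 := hp.norm_le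
    calc _ ≤ ‖p‖ * ‖star s * s - p‖ * ‖p‖ := norm_mul₃_le
      _ ≤ 1 * ‖star s * s - p‖ * 1 := by gcongr
      _ ≤ _ := by simpa using hn
  obtain ⟨k, hk, hkh, -, hc⟩ := exists_invSqrt hsa le_rfl hle
  have hcp : Commute k p := by
    refine hc p ?_
    simp only [Commute, SemiconjBy, hh, mul_add, add_mul, mul_sub, sub_mul, hpp, mul_one, one_mul,
      sub_self, mul_assoc]
    simp [← mul_assoc, hpp]
  rw [equivToProjIn_iff hp hx]
  refine ⟨s * p * k, closedRightIdeal_mul_mem (closedRightIdeal_mul_mem hs _) _, ?_⟩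
  have h1 : p * h * p = p * (star s * s) * p := by
    have : p * h * p = (p * p) * (star s * s) * (p * p) + (p * p - p * p * p) := by
      rw [hh]; noncomm_ring
    rw [this]; simp [hpp]
  calc star (s * p * k) * (s * p * k) = k * (p * (star s * s) * p) * k := by
        simp only [star_mul, hps, hk.star_eq, mul_assoc]
    _ = (k * p) * h * (p * k) := by rw [← h1]; noncomm_ring
    _ = p * (k * h * k) * p := by rw [hcp.eq, ← hcp.eq]; nth_rw 1 [hcp.eq]; noncomm_ring
    _ = p := by rw [hkh, mul_one, hpp]

/-- An almost unitary element of a corner is close to a unitary of the corner. -/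
lemma exists_isUnitaryInCorner_near {q t : A} (hq : IsStarProjection q) (ht : q * t * q = t)
    {δ : ℝ} (hδ : δ ≤ 1 / 16) (h1 : ‖star t * t - q‖ ≤ δ) (h2 : ‖t * star t - q‖ ≤ δ) :
    ∃ w, IsUnitaryInCorner q w ∧ ‖w - t‖ ≤ 4 * δ := by
  have hqq : q * q = q := hq.isIdempotentElem
  have hqs : star q = q := hq.isSelfAdjoint
  have hq1 : ‖q‖ ≤ 1 := hq.norm_le
  have hqt : q * t = t := by rw [← ht, ← mul_assoc, ← mul_assoc, hqq]
  have htq : t * q = t := by rw [← ht, mul_assoc, hqq]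
  have hst : q * star t = star t := by simpa [hqs] using congrArg star htq
  set h := star t * t + (1 - q) with hh
  have hsa : IsSelfAdjoint h := by simp [IsSelfAdjoint, hh, hqs]
  have hle : ‖h - 1‖ ≤ δ := by
    have : h - 1 = star t * t - q := by rw [hh]; abel
    rwa [this]
  obtain ⟨k, hk, hkh, hk1, hc⟩ := exists_invSqrt hsa (by linarith) hle
  have hcq : k * q = q * k := by
    refine hc q ?_
    simp only [Commute, SemiconjBy, hh, mul_add, add_mul, mul_sub, sub_mul, hqq, mul_one, one_mul,
      sub_self, mul_assoc, htq]
    rw [← mul_assoc, hst]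
  have hhq : h * q = star t * t := by
    simp only [hh, add_mul, sub_mul, hqq, one_mul, mul_assoc, htq]; simp
  have hw : star (t * k) * (t * k) = q := by
    calc star (t * k) * (t * k) = k * (star t * t) * k := by
          simp only [star_mul, hk.star_eq, mul_assoc]
      _ = k * h * (q * k) := by rw [← hhq]; noncomm_ring
      _ = (k * h * k) * q := by rw [← hcq]; noncomm_ring
      _ = q := by rw [hkh, one_mul]
  set w := t * k with hwd
  have hqw : q * w = w := by rw [hwd, ← mul_assoc, hqt]
  have hwq : w * q = w := mul_eq_self_of_star_mul_eq hq hw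
  have hws : star w * q = star w := by simpa [hqs] using congrArg star hqw
  have hnt : ‖t‖ ≤ 2 := by
    have h3 : ‖t‖ * ‖t‖ ≤ 2 * 2 := by
      rw [← CStarRing.norm_star_mul_self]
      calc ‖star t * t‖ = ‖(star t * t - q) + q‖ := by simp
        _ ≤ δ + 1 := (norm_add_le _ _).trans (add_le_add h1 hq1)
        _ ≤ _ := by linarith
    nlinarith [norm_nonneg t]
  have hnw : ‖star w‖ ≤ 1 := by
    rw [norm_star]
    have h3 : ‖w‖ * ‖w‖ ≤ 1 := by rw [← CStarRing.norm_star_mul_self, hw]; exact hq1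
    nlinarith [norm_nonneg w]
  have hwt : ‖w - t‖ ≤ 4 * δ := by
    have : w - t = t * (k - 1) := by rw [hwd]; noncomm_ring
    rw [this]
    calc _ ≤ ‖t‖ * ‖k - 1‖ := norm_mul_le _ _
      _ ≤ 2 * (2 * δ) := by gcongr
      _ = _ := by ring
  refine ⟨w, ⟨⟨w, by rw [hqw, hwq]⟩, hw, ?_⟩, hwt⟩
  -- Since `d⋆ d = -d`, the norm of `d` is `0` or `1`. The estimate `‖d‖ ≤ 13 δ < 1`, which is where
  -- `1/16` is used, leaves only `0`.
  set d := w * star w - q with hd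
  have hdd : star d * d = -d := by
    have e1 : w * star w * (w * star w) = w * star w := by
      rw [mul_assoc, ← mul_assoc (star w), hw, ← mul_assoc, hwq]
    have e2 : q * (w * star w) = w * star w := by rw [← mul_assoc, hqw]
    have e3 : w * star w * q = w * star w := by rw [mul_assoc, hws]
    have : star d = d := by simp [hd, hqs]
    rw [this]
    simp only [hd, mul_sub, sub_mul, e1, e2, e3, hqq]
    abel
  have hdn : ‖d‖ < 1 := by
    have : d = (w - t) * star w + t * star (w - t) + (t * star t - q) := by
      simp only [hd, star_sub, mul_sub, sub_mul]; abel
    rw [this]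
    calc _ ≤ ‖w - t‖ * ‖star w‖ + ‖t‖ * ‖star (w - t)‖ + ‖t * star t - q‖ :=
          (norm_add₃_le).trans (by gcongr <;> exact norm_mul_le _ _)
      _ ≤ (4 * δ) * 1 + 2 * (4 * δ) + δ := by
          gcongr
          · exact (norm_nonneg _).trans hwt
          · rwa [norm_star]
      _ < 1 := by linarith
  have h0 : ‖d‖ * ‖d‖ = ‖d‖ := by rw [← CStarRing.norm_star_mul_self, hdd, norm_neg]
  have : ‖d‖ = 0 := by
    nlinarith [norm_nonneg d]
  exact sub_eq_zero.1 (norm_eq_zero.1 this)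

end Perturbation

/-! ### Averages over a tower and diagonals of two towers -/

section StarFree

variable {R : Type*} [Ring R] {n : ℕ} [NeZero n] {e V f : ZMod n → R}

/-- The element of the fixed point algebra obtained by averaging `V` over the tower `e`. -/
def towerAverage (e V : ZMod n → R) : R := ∑ k, V k * e k

lemma towerAverage_intertwine {b : ZMod n → R} (hbe : ∀ j k, Commute (b j) (e k))
    (hVb : ∀ j k, V j * b k = b (k + 1) * V j) (k : ZMod n) :
    towerAverage e V * b k = b (k + 1) * towerAverage e V := by
  rw [towerAverage, Finset.sum_mul, Finset.mul_sum]
  refine Finset.sum_congr rfl fun j _ => ?_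
  rw [mul_assoc, ← (hbe k j).eq, ← mul_assoc, hVb, mul_assoc]

lemma towerAverage_commute {c : R} (hce : ∀ k, Commute c (e k)) (hcV : ∀ k, Commute c (V k)) :
    Commute c (towerAverage e V) :=
  Commute.sum_right _ _ _ fun k _ => (hcV k).mul_right (hce k)

/-- The invariant diagonals of the product of two commuting towers. -/
def towerDiagonal (e f : ZMod n → R) (l : ZMod n) : R := ∑ j, e j * f (j + l)

lemma sum_towerDiagonal : ∑ l, towerDiagonal e f l = (∑ j, e j) * ∑ j, f j := by
  simp only [towerDiagonal]
  rw [Finset.sum_comm, Finset.sum_mul]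
  refine Finset.sum_congr rfl fun j _ => ?_
  rw [← Finset.mul_sum]
  exact congrArg _ (Equiv.sum_comp (Equiv.addLeft j) f)

lemma towerDiagonal_commute {c : R} (hce : ∀ k, Commute c (e k)) (hcf : ∀ k, Commute c (f k))
    (l : ZMod n) : Commute c (towerDiagonal e f l) :=
  Commute.sum_right _ _ _ fun k _ => (hce k).mul_right (hcf _)

end StarFree

/-! ### Towers, shifts and cycled partitions in a star ring -/

section Algebra

variable {R : Type*} [Ring R] [StarRing R] {n : ℕ}

/-- A cyclic tower of mutually orthogonal projections. -/
structure IsTower (α : R →+* R) (e : ZMod n → R) : Prop where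
  star_eq : ∀ k, star (e k) = e k
  mul_self : ∀ k, e k * e k = e k
  mul_ne : ∀ j k, j ≠ k → e j * e k = 0
  map : ∀ k, α (e k) = e (k + 1)

/-- `V` is a cyclic family of partial unitaries with support `g` which shifts the tower `e`. -/
structure IsShift (α : R →+* R) (g : R) (e V : ZMod n → R) : Prop where
  star_g : star g = g
  mul_g : g * g = g
  map_g : α g = g
  comm_g : ∀ k, g * e k = e k * g
  map : ∀ k, α (V k) = V (k + 1)
  mul_star : ∀ k, V k * star (V k) = g
  star_mul : ∀ k, star (V k) * V k = g
  mul_right_g : ∀ k, V k * g = V k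
  shift : ∀ j k, V j * e k = e (k + 1) * V j

section Shift

variable {α : R →+* R} {g : R} {e V : ZMod n → R}

lemma IsShift.g_mul (hV : IsShift α g e V) (k : ZMod n) : g * V k = V k := by
  rw [← hV.mul_star k, mul_assoc, hV.star_mul, hV.mul_right_g]

lemma IsShift.star_mul_g (hV : IsShift α g e V) (k : ZMod n) : star (V k) * g = star (V k) := by
  simpa [hV.star_g] using congrArg star (hV.g_mul k)

lemma IsShift.g_mul_star (hV : IsShift α g e V) (k : ZMod n) : g * star (V k) = star (V k) := by
  simpa [hV.star_g] using congrArg star (hV.mul_right_g k)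

/-- `V j` is unitary only in the corner of `g`, so its inverse intertwines `b` after inserting `g`,
which `b` must commute with. -/
lemma IsShift.star_intertwine (hV : IsShift α g e V) {b : ZMod n → R}
    (hbg : ∀ k, Commute (b k) g) (hVb : ∀ j k, V j * b k = b (k + 1) * V j) (j k : ZMod n) :
    star (V j) * b (k + 1) = b k * star (V j) := by
  calc star (V j) * b (k + 1) = star (V j) * (b (k + 1) * g) := by
        rw [(hbg _).eq, ← mul_assoc, hV.star_mul_g]
    _ = star (V j) * V j * (b k * star (V j)) := by
        rw [← hV.mul_star j, ← mul_assoc, ← mul_assoc, mul_assoc (star (V j)), ← hVb]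
        noncomm_ring
    _ = b k * star (V j) := by
        rw [hV.star_mul, ← mul_assoc, ← (hbg k).eq, mul_assoc, hV.g_mul_star]

end Shift

/-- A partition of a projection `∑ k, P k` cyclically permuted by an invariant `w`. -/
structure IsCycled (α : R →+* R) (w r : R) (P : ZMod n → R) : Prop where
  star_eq : ∀ k, star (P k) = P k
  mul_self : ∀ k, P k * P k = P k
  mul_ne : ∀ j k, j ≠ k → P j * P k = 0
  map : ∀ k, α (P k) = P k
  map_w : α w = w
  mul_star : w * star w = r
  star_mul : star w * w = r
  mul_r : ∀ k, P k * r = P k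
  shift : ∀ k, w * P (k + 1) = P k * w

variable {α : R →+* R} {w r : R} {P : ZMod n → R}

namespace IsCycled

lemma r_mul (h : IsCycled α w r P) (k : ZMod n) : r * P k = P k := by
  have hr : star r = r := by rw [← h.mul_star]; simp
  have := congrArg star (h.mul_r k)
  simpa [h.star_eq, hr] using this

lemma pow_shift (h : IsCycled α w r P) (i : ℕ) (k : ZMod n) :
    w ^ i * P (k + i) = P k * w ^ i := by
  induction i generalizing k with
  | zero => simp
  | succ i ih =>
    rw [pow_succ, mul_assoc, show k + ((i + 1 : ℕ) : ZMod n) = (k + i) + 1 by push_cast; ring,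
      h.shift, ← mul_assoc, ih, mul_assoc]

lemma star_pow_shift (h : IsCycled α w r P) (i : ℕ) (k : ZMod n) :
    star w ^ i * P k = P (k + i) * star w ^ i := by
  have := congrArg star (h.pow_shift i k)
  simp only [StarMul.star_mul, h.star_eq, star_pow] at this
  exact this.symm

/-- Peel off the innermost `w w⋆ = r`: there `P k` has moved to `P (k + i)`, on which `r` acts as
the unit. -/
lemma pow_mul_star_pow (h : IsCycled α w r P) (i : ℕ) (k : ZMod n) :
    w ^ i * star w ^ i * P k = P k := by
  induction i generalizing k with
  | zero => simp
  | succ i ih =>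
    calc w ^ (i + 1) * star w ^ (i + 1) * P k
        = w ^ i * ((w * star w) * (star w ^ i * P k)) := by
          rw [pow_succ w, pow_succ' (star w)]; noncomm_ring
      _ = w ^ i * ((w * star w) * P (k + i)) * star w ^ i := by
          rw [h.star_pow_shift]; noncomm_ring
      _ = w ^ i * star w ^ i * P k := by
          rw [h.mul_star, h.r_mul, mul_assoc, ← h.star_pow_shift, mul_assoc]
      _ = P k := ih k

lemma star_pow_mul_pow (h : IsCycled α w r P) (i : ℕ) (k : ZMod n) :
    star w ^ i * w ^ i * P (k + i) = P (k + i) := by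
  induction i generalizing k with
  | zero => simp
  | succ i ih =>
    calc star w ^ (i + 1) * w ^ (i + 1) * P (k + (i + 1 : ℕ))
        = star w ^ i * ((star w * w) * (w ^ i * P ((k + 1) + i))) := by
          rw [pow_succ (star w), pow_succ' w]
          rw [show k + ((i + 1 : ℕ) : ZMod n) = (k + 1) + i by push_cast; ring]; noncomm_ring
      _ = star w ^ i * ((star w * w) * P (k + 1)) * w ^ i := by
          rw [h.pow_shift]; noncomm_ring
      _ = star w ^ i * w ^ i * P ((k + 1) + i) := by
          rw [h.star_mul, h.r_mul, mul_assoc, ← h.pow_shift, mul_assoc]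
      _ = P ((k + 1) + i) := ih _
      _ = _ := by rw [show k + ((i + 1 : ℕ) : ZMod n) = (k + 1) + i by push_cast; ring]

end IsCycled

variable [NeZero n] {e V f : ZMod n → R} {g : R}

/-- `α` sends each summand to the next one, cyclically. -/
lemma map_towerAverage (he : IsTower α e) (hV : IsShift α g e V) :
    α (towerAverage e V) = towerAverage e V := by
  simp only [towerAverage, map_sum, map_mul, he.map, hV.map]
  exact Equiv.sum_comp (Equiv.addRight (1 : ZMod n)) fun k => V k * e k

lemma towerAverage_mul_tower (he : IsTower α e) (j : ZMod n) :
    towerAverage e V * e j = V j * e j := by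
  rw [towerAverage, Finset.sum_mul, Finset.sum_eq_single j]
  · rw [mul_assoc, he.mul_self]
  · intro k _ hk
    rw [mul_assoc, he.mul_ne k j hk, mul_zero]
  · simp

lemma tower_mul_towerAverage (he : IsTower α e) (hV : IsShift α g e V) (j : ZMod n) :
    e (j + 1) * towerAverage e V = V j * e j := by
  rw [towerAverage, Finset.mul_sum, Finset.sum_eq_single j]
  · rw [hV.shift, ← mul_assoc, he.mul_self]
  · intro k _ hk
    rw [hV.shift, ← mul_assoc, he.mul_ne _ _ (fun h => hk (add_right_cancel h).symm), zero_mul]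
  · simp

lemma towerAverage_shift (he : IsTower α e) (hV : IsShift α g e V) (j : ZMod n) :
    towerAverage e V * e j = e (j + 1) * towerAverage e V := by
  rw [towerAverage_mul_tower he, tower_mul_towerAverage he hV]

lemma star_towerAverage (he : IsTower α e) :
    star (towerAverage e V) = ∑ k, e k * star (V k) := by
  simp [towerAverage, star_sum, he.star_eq]

lemma towerAverage_mul_star (he : IsTower α e) (hV : IsShift α g e V) :
    towerAverage e V * star (towerAverage e V) = (∑ k, e k) * g := by
  rw [star_towerAverage he, Finset.mul_sum, Finset.sum_mul,
    ← Equiv.sum_comp (Equiv.addRight (1 : ZMod n)) fun k => e k * g]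
  refine Finset.sum_congr rfl fun k _ => ?_
  rw [← mul_assoc, towerAverage_mul_tower he, hV.shift, mul_assoc, hV.mul_star]
  rfl

lemma star_towerAverage_mul (he : IsTower α e) (hV : IsShift α g e V) :
    star (towerAverage e V) * towerAverage e V = (∑ k, e k) * g := by
  nth_rw 2 [towerAverage]
  rw [Finset.mul_sum, Finset.sum_mul]
  refine Finset.sum_congr rfl fun k _ => ?_
  have h1 : star (towerAverage e V) * e (k + 1) = e k * star (V k) := by
    have := congrArg star (tower_mul_towerAverage he hV k)
    simpa [he.star_eq] using this
  calc star (towerAverage e V) * (V k * e k)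
      = star (towerAverage e V) * e (k + 1) * V k := by rw [hV.shift, mul_assoc]
    _ = e k * g := by rw [h1, mul_assoc, hV.star_mul]

/-- The element agreeing with `w` on all but one of the projections `P k`, and with
`(w⋆) ^ (n - 1)` on the remaining one. -/
def closedCycle (w : R) (P : ZMod n → R) : R :=
  ∑ k, (if k = 0 then star w ^ (n - 1) else w) * P k

/-! ### The closed cycle is an invariant unitary of order `n` -/

namespace IsCycled

lemma sum_mul (h : IsCycled α w r P) (j : ZMod n) : (∑ k, P k) * P j = P j := by
  rw [Finset.sum_mul, Finset.sum_eq_single j (fun k _ hk => h.mul_ne k j hk) (by simp),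
    h.mul_self]

lemma mul_sum (h : IsCycled α w r P) (j : ZMod n) : P j * (∑ k, P k) = P j := by
  rw [Finset.mul_sum, Finset.sum_eq_single j (fun k _ hk => h.mul_ne j k hk.symm) (by simp),
    h.mul_self]

lemma sum_mul_sum (h : IsCycled α w r P) : (∑ k, P k) * (∑ k, P k) = ∑ k, P k := by
  rw [Finset.mul_sum]; exact Finset.sum_congr rfl fun k _ => h.sum_mul k

lemma star_sum (h : IsCycled α w r P) : star (∑ k, P k) = ∑ k, P k := by
  simp [_root_.star_sum, h.star_eq]

lemma natCast_pred : ((n - 1 : ℕ) : ZMod n) = -1 := by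
  have : 1 ≤ n := NeZero.one_le
  rw [Nat.cast_sub this]; simp

lemma closedCycle_mul (h : IsCycled α w r P) (k : ZMod n) :
    closedCycle w P * P k = (if k = 0 then star w ^ (n - 1) else w) * P k := by
  rw [closedCycle, Finset.sum_mul, Finset.sum_eq_single k]
  · rw [mul_assoc, h.mul_self]
  · intro j _ hj
    rw [mul_assoc, h.mul_ne j k hj, mul_zero]
  · simp

lemma closedCycle_mul_of_ne (h : IsCycled α w r P) {k : ZMod n} (hk : k ≠ 0) :
    closedCycle w P * P k = w * P k := by rw [h.closedCycle_mul, if_neg hk]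

lemma closedCycle_mul_zero (h : IsCycled α w r P) :
    closedCycle w P * P 0 = star w ^ (n - 1) * P 0 := by rw [h.closedCycle_mul, if_pos rfl]

/-- Both branches lower the index by one: `(w⋆)^(n-1)` raises it by `n - 1`, which is `-1` modulo
`n`. -/
lemma unit_shift (h : IsCycled α w r P) (k : ZMod n) :
    (if k = 0 then star w ^ (n - 1) else w) * P k
      = P (k - 1) * (if k = 0 then star w ^ (n - 1) else w) := by
  split_ifs with hk
  · rw [h.star_pow_shift, natCast_pred, sub_eq_add_neg]
  · rw [← h.shift, sub_add_cancel]

lemma star_unit_mul (h : IsCycled α w r P) (k : ZMod n) :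
    star (if k = 0 then star w ^ (n - 1) else w) * (if k = 0 then star w ^ (n - 1) else w) * P k
      = P k := by
  split_ifs with hk
  · rw [star_pow, star_star, h.pow_mul_star_pow]
  · rw [h.star_mul, h.r_mul]

lemma unit_mul_star (h : IsCycled α w r P) (k : ZMod n) :
    (if k = 0 then star w ^ (n - 1) else w) * star (if k = 0 then star w ^ (n - 1) else w)
      * P (k - 1) = P (k - 1) := by
  split_ifs with hk
  · rw [star_pow, star_star]
    have := h.star_pow_mul_pow (n - 1) k
    rwa [natCast_pred, ← sub_eq_add_neg] at this
  · rw [h.mul_star, h.r_mul]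

lemma mul_closedCycle (h : IsCycled α w r P) (k : ZMod n) :
    P (k - 1) * closedCycle w P = (if k = 0 then star w ^ (n - 1) else w) * P k := by
  rw [closedCycle, Finset.mul_sum, Finset.sum_eq_single k]
  · rw [h.unit_shift, ← mul_assoc, h.mul_self]
  · intro j _ hj
    rw [h.unit_shift, ← mul_assoc, h.mul_ne _ _ (fun h => hj (sub_left_injective h).symm),
      zero_mul]
  · simp

lemma closedCycle_mul_sum (h : IsCycled α w r P) :
    closedCycle w P * (∑ k, P k) = closedCycle w P := by
  rw [Finset.mul_sum, closedCycle]
  exact Finset.sum_congr rfl fun k _ => h.closedCycle_mul k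

lemma sum_mul_closedCycle (h : IsCycled α w r P) :
    (∑ k, P k) * closedCycle w P = closedCycle w P := by
  rw [Finset.sum_mul, closedCycle, ← (Equiv.subRight (1 : ZMod n)).sum_comp]
  exact Finset.sum_congr rfl fun k _ => h.mul_closedCycle k

lemma star_closedCycle_mul (h : IsCycled α w r P) :
    star (closedCycle w P) * closedCycle w P = ∑ k, P k := by
  nth_rw 2 [← h.closedCycle_mul_sum]
  rw [Finset.mul_sum, Finset.mul_sum]
  refine Finset.sum_congr rfl fun k _ => ?_
  have h1 : star (closedCycle w P) * P (k - 1)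
      = P k * star (if k = 0 then star w ^ (n - 1) else w) := by
    have := congrArg star (h.mul_closedCycle k)
    rwa [StarMul.star_mul, StarMul.star_mul, h.star_eq, h.star_eq] at this
  rw [h.closedCycle_mul, h.unit_shift, ← mul_assoc, h1, mul_assoc]
  have := congrArg star (h.star_unit_mul k)
  rwa [StarMul.star_mul, StarMul.star_mul, star_star, h.star_eq] at this

lemma closedCycle_mul_star (h : IsCycled α w r P) :
    closedCycle w P * star (closedCycle w P) = ∑ k, P k := by
  rw [← h.sum_mul_closedCycle, StarMul.star_mul, h.star_sum]
  nth_rw 1 [h.sum_mul_closedCycle]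
  rw [Finset.mul_sum, Finset.mul_sum, ← (Equiv.subRight (1 : ZMod n)).sum_comp P,
    ← (Equiv.subRight (1 : ZMod n)).sum_comp]
  refine Finset.sum_congr rfl fun k _ => ?_
  have h1 : star (closedCycle w P) * P (k - 1)
      = P k * star (if k = 0 then star w ^ (n - 1) else w) := by
    have := congrArg star (h.mul_closedCycle k)
    rwa [StarMul.star_mul, StarMul.star_mul, h.star_eq, h.star_eq] at this
  have h2 := congrArg star (h.unit_shift k)
  rw [StarMul.star_mul, StarMul.star_mul, h.star_eq, h.star_eq] at h2
  simp only [Equiv.subRight_apply]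
  rw [h1, ← mul_assoc, h.closedCycle_mul, mul_assoc, h2, ← mul_assoc, h.unit_mul_star]

lemma map_closedCycle (h : IsCycled α w r P) (hα : ∀ x, α (star x) = star (α x)) :
    α (closedCycle w P) = closedCycle w P := by
  rw [closedCycle, map_sum]
  refine Finset.sum_congr rfl fun k _ => ?_
  rw [map_mul, h.map]
  split_ifs
  · rw [map_pow, hα, h.map_w]
  · rw [h.map_w]

/-- The first `i` steps start from the indices `l, …, l - i + 1`, none of which is `0` modulo `n`,
so the exceptional branch is not met. -/
lemma closedCycle_pow_mul (h : IsCycled α w r P) (i l : ℕ) (hil : i ≤ l) (hl : l < n) :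
    closedCycle w P ^ i * P l = w ^ i * P l := by
  induction i with
  | zero => simp
  | succ i ih =>
    have hsub : (l : ZMod n) = ((l - i : ℕ) : ZMod n) + (i : ZMod n) := by
      rw [← Nat.cast_add, Nat.sub_add_cancel (by omega)]
    have hne : ((l - i : ℕ) : ZMod n) ≠ 0 := by
      rw [Ne, ZMod.natCast_eq_zero_iff]
      intro hd
      exact absurd (Nat.le_of_dvd (by omega) hd) (by omega)
    rw [pow_succ', mul_assoc, ih (by omega), hsub, h.pow_shift, ← mul_assoc,
      h.closedCycle_mul_of_ne hne, mul_assoc, ← h.pow_shift, ← mul_assoc, ← pow_succ']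

/-- From `P l`, `l` steps lead to `P 0`, one exceptional step to `P (n-1)`, and `n - 1 - l` steps
back to `P l`. The product `w^(n-1-l) (w⋆)^(n-1) w^l` cancels on `P l`. -/
lemma closedCycle_pow (h : IsCycled α w r P) : closedCycle w P ^ n = ∑ k, P k := by
  have hP : ∀ k, closedCycle w P ^ n * P k = P k := by
    intro k
    set l := k.val with hl
    have hln : l < n := ZMod.val_lt k
    have hk : k = (l : ZMod n) := by simp [hl]
    have e1 : closedCycle w P ^ (l + 1) * P l = star w ^ (n - 1) * w ^ l * P l := by
      have := h.pow_shift l 0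
      rw [zero_add] at this
      rw [pow_succ', mul_assoc, h.closedCycle_pow_mul l l le_rfl hln, this, ← mul_assoc,
        h.closedCycle_mul_zero, mul_assoc, ← this, mul_assoc]
    have e2 : star w ^ (n - 1) * w ^ l * P l = star w ^ (n - 1 - l) * P l := by
      have h3 : star w ^ (n - 1) = star w ^ (n - 1 - l) * star w ^ l := by
        rw [← pow_add, Nat.sub_add_cancel (by omega)]
      have h4 := h.star_pow_mul_pow l 0
      rw [zero_add] at h4
      rw [h3, mul_assoc, mul_assoc, ← mul_assoc (star w ^ l), h4]
    have hc : (l : ZMod n) + ((n - 1 - l : ℕ) : ZMod n) = ((n - 1 : ℕ) : ZMod n) := by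
      rw [← Nat.cast_add]; congr 1; omega
    have e3 : star w ^ (n - 1 - l) * P l
        = P ((n - 1 : ℕ) : ZMod n) * star w ^ (n - 1 - l) := by
      rw [h.star_pow_shift, hc]
    have hn : n = (n - 1 - l) + (l + 1) := by omega
    have h5 : closedCycle w P ^ n = closedCycle w P ^ (n - 1 - l) * closedCycle w P ^ (l + 1) := by
      rw [← pow_add, ← hn]
    rw [hk, h5, mul_assoc, e1, e2, e3, ← mul_assoc,
      h.closedCycle_pow_mul _ _ (by omega) (by omega), mul_assoc, ← e3, ← mul_assoc,
      h.pow_mul_star_pow]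
  have h1 : closedCycle w P ^ n * (∑ k, P k) = closedCycle w P ^ n := by
    obtain ⟨m, hm⟩ : ∃ m, n = m + 1 := Nat.exists_eq_succ_of_ne_zero (NeZero.ne n)
    rw [show closedCycle w P ^ n = closedCycle w P ^ m * closedCycle w P by
      rw [← pow_succ, ← hm], mul_assoc, h.closedCycle_mul_sum]
  rw [← h1, Finset.mul_sum]
  exact Finset.sum_congr rfl fun k _ => hP k

/-- If `w` intertwines the cyclic family `b` with its shift, and so does the cyclic family of
adjoints, then the same holds for the closed cycle. -/
lemma closedCycle_intertwine {b : ZMod n → R}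
    (hbP : ∀ j k, Commute (b j) (P k)) (hb : ∀ k, w * b k = b (k + 1) * w)
    (hb' : ∀ k, star w * b (k + 1) = b k * star w) (k : ZMod n) :
    closedCycle w P * b k = b (k + 1) * closedCycle w P := by
  have hpow : ∀ (i : ℕ) (k : ZMod n), star w ^ i * b k = b (k - i) * star w ^ i := by
    intro i
    induction i with
    | zero => simp
    | succ i ih =>
      intro k
      have := hb' (k - i - 1)
      rw [sub_add_cancel] at this
      rw [pow_succ', mul_assoc, ih, ← mul_assoc, this, mul_assoc,
        show k - ((i + 1 : ℕ) : ZMod n) = k - i - 1 by push_cast; ring]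
  rw [closedCycle, Finset.sum_mul, Finset.mul_sum]
  refine Finset.sum_congr rfl fun j _ => ?_
  rw [mul_assoc, ← (hbP k j).eq, ← mul_assoc, ← mul_assoc]
  split_ifs
  -- Each `w⋆` lowers the index of `b` by one, so `(w⋆)^(n-1)` raises it by one modulo `n`, as `w`
  -- does.
  · rw [hpow, natCast_pred, sub_neg_eq_add]
  · rw [hb]

end IsCycled

lemma towerAverage_mul_g (hV : IsShift α g e V) : towerAverage e V * g = towerAverage e V := by
  rw [towerAverage, Finset.sum_mul]
  refine Finset.sum_congr rfl fun k _ => ?_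
  rw [mul_assoc, ← hV.comm_g, ← mul_assoc, hV.mul_right_g]

lemma g_mul_towerAverage (hV : IsShift α g e V) : g * towerAverage e V = towerAverage e V := by
  rw [towerAverage, Finset.mul_sum]
  exact Finset.sum_congr rfl fun k _ => by rw [← mul_assoc, hV.g_mul]

lemma star_towerAverage_intertwine (he : IsTower α e) (hV : IsShift α g e V) {b : ZMod n → R}
    (hbe : ∀ j k, Commute (b j) (e k)) (hbg : ∀ k, Commute (b k) g)
    (hVb : ∀ j k, V j * b k = b (k + 1) * V j) (k : ZMod n) :
    star (towerAverage e V) * b (k + 1) = b k * star (towerAverage e V) := by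
  rw [star_towerAverage he, Finset.sum_mul, Finset.mul_sum]
  refine Finset.sum_congr rfl fun j _ => ?_
  rw [mul_assoc, hV.star_intertwine hbg hVb, ← mul_assoc, ← (hbe k j).eq, mul_assoc]

lemma star_towerDiagonal (he : IsTower α e) (hf : IsTower α f) (hfe : ∀ j k, Commute (f j) (e k))
    (l : ZMod n) : star (towerDiagonal e f l) = towerDiagonal e f l := by
  simp only [towerDiagonal, star_sum, star_mul, he.star_eq, hf.star_eq]
  exact Finset.sum_congr rfl fun j _ => (hfe _ _).eq

/-- `α` advances both towers together, keeping the offset `l`. -/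
lemma map_towerDiagonal (he : IsTower α e) (hf : IsTower α f) (l : ZMod n) :
    α (towerDiagonal e f l) = towerDiagonal e f l := by
  simp only [towerDiagonal, map_sum, map_mul, he.map, hf.map]
  rw [← Equiv.sum_comp (Equiv.addRight (1 : ZMod n)) fun j => e j * f (j + l)]
  refine Finset.sum_congr rfl fun j _ => ?_
  rw [Equiv.coe_addRight, add_right_comm]

lemma tower_mul_sum (he : IsTower α e) (j : ZMod n) : e j * ∑ k, e k = e j := by
  rw [Finset.mul_sum, Finset.sum_eq_single j (fun k _ hk => he.mul_ne j k hk.symm) (by simp),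
    he.mul_self]

lemma tower_mul_towerDiagonal (he : IsTower α e) (j l : ZMod n) :
    e j * towerDiagonal e f l = e j * f (j + l) := by
  rw [towerDiagonal, Finset.mul_sum, Finset.sum_eq_single j]
  · rw [← mul_assoc, he.mul_self]
  · intro k _ hk
    rw [← mul_assoc, he.mul_ne j k hk.symm, zero_mul]
  · simp

lemma towerDiagonal_mul (he : IsTower α e) (hfe : ∀ j k, Commute (f j) (e k)) (k l : ZMod n) :
    towerDiagonal e f k * towerDiagonal e f l = ∑ j, e j * (f (j + k) * f (j + l)) := by
  nth_rw 1 [towerDiagonal]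
  rw [Finset.sum_mul]
  refine Finset.sum_congr rfl fun j _ => ?_
  rw [← (hfe _ _).eq, mul_assoc, tower_mul_towerDiagonal he, ← mul_assoc, (hfe _ _).eq, mul_assoc]

/-- The diagonals of two commuting towers are cycled by the average of a shift of the first. -/
lemma isCycled_towerDiagonal (he : IsTower α e) (hf : IsTower α f) (hV : IsShift α g e V)
    (hfe : ∀ j k, Commute (f j) (e k)) (hfg : ∀ k, Commute (f k) g)
    (hfV : ∀ j k, Commute (f j) (V k)) :
    IsCycled α (towerAverage e V) ((∑ k, e k) * g) fun l => towerDiagonal e f l * g := by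
  have hg : ∀ l, Commute g (towerDiagonal e f l) := fun l =>
    towerDiagonal_commute hV.comm_g (fun k => (hfg k).symm) l
  have hmul : ∀ k l, towerDiagonal e f k * g * (towerDiagonal e f l * g)
      = towerDiagonal e f k * towerDiagonal e f l * g := fun k l => by
    rw [mul_assoc, ← mul_assoc g, (hg l).eq, mul_assoc _ g, hV.mul_g, mul_assoc]
  refine ⟨fun k => ?_, fun k => ?_, fun j k hjk => ?_, fun k => ?_, map_towerAverage he hV,
    towerAverage_mul_star he hV, star_towerAverage_mul he hV, fun k => ?_, fun k => ?_⟩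
  · rw [star_mul, star_towerDiagonal he hf hfe, hV.star_g, (hg k).eq]
  · rw [hmul, towerDiagonal_mul he hfe]
    simp only [hf.mul_self]
    rfl
  · rw [hmul, towerDiagonal_mul he hfe]
    simp [hf.mul_ne _ _ (fun h => hjk (add_left_cancel h))]
  · rw [map_mul, map_towerDiagonal he hf, hV.map_g]
  · have h1 : towerDiagonal e f k * ∑ j, e j = towerDiagonal e f k := by
      rw [towerDiagonal, Finset.sum_mul]
      refine Finset.sum_congr rfl fun j _ => ?_
      rw [← (hfe _ _).eq, mul_assoc, tower_mul_sum he]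
    have h2 : g * ∑ j, e j = (∑ j, e j) * g := by
      rw [Finset.mul_sum, Finset.sum_mul]
      exact Finset.sum_congr rfl fun j _ => hV.comm_g j
    rw [mul_assoc, ← mul_assoc g, h2, mul_assoc, hV.mul_g, ← mul_assoc, h1]
  -- The average advances `e` but commutes with `f`, so the offset between the towers drops by one.
  · have h1 : towerAverage e V * towerDiagonal e f (k + 1)
        = towerDiagonal e f k * towerAverage e V := by
      rw [towerDiagonal, towerDiagonal, Finset.mul_sum, Finset.sum_mul,
        ← Equiv.sum_comp (Equiv.addRight (1 : ZMod n))
          fun j => e j * f (j + k) * towerAverage e V]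
      refine Finset.sum_congr rfl fun j _ => ?_
      rw [Equiv.coe_addRight, ← mul_assoc, towerAverage_shift he hV, mul_assoc, mul_assoc,
        ← (towerAverage_commute (hfe _) (hfV _)).eq, add_right_comm, add_assoc]
    rw [← mul_assoc, h1, mul_assoc, mul_assoc, towerAverage_mul_g hV, g_mul_towerAverage hV]

/-- From two commuting towers and a shift of the first one obtain an invariant unitary of order `n`
in a corner, inducing the same permutation as the shift. -/
theorem exists_cyclic_unitary (hα : ∀ x, α (star x) = star (α x))
    (he : IsTower α e) (hf : IsTower α f) (hV : IsShift α g e V)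
    (hfe : ∀ j k, Commute (f j) (e k)) (hfg : ∀ k, Commute (f k) g)
    (hfV : ∀ j k, Commute (f j) (V k)) {q : R} (hq : q = (∑ k, e k) * g * ∑ k, f k) :
    star q = q ∧ q * q = q ∧ ∃ W : R, star W * W = q ∧ W * star W = q ∧ q * W = W ∧ W * q = W ∧
      α W = W ∧ W ^ n = q ∧ ∀ b : ZMod n → R, (∀ j k, Commute (b j) (e k)) →
        (∀ j k, Commute (b j) (f k)) → (∀ k, Commute (b k) g) →
        (∀ j k, V j * b k = b (k + 1) * V j) → ∀ k, W * b k = b (k + 1) * W := by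
  have h := isCycled_towerDiagonal he hf hV hfe hfg hfV
  have hsum : ∑ l, towerDiagonal e f l * g = q := by
    have : g * (∑ k, f k) = (∑ k, f k) * g := by
      rw [Finset.mul_sum, Finset.sum_mul]
      exact Finset.sum_congr rfl fun k _ => (hfg k).eq.symm
    rw [← Finset.sum_mul, sum_towerDiagonal, hq, mul_assoc, mul_assoc, this]
  refine ⟨hsum ▸ h.star_sum, hsum ▸ h.sum_mul_sum, _, hsum ▸ h.star_closedCycle_mul,
    hsum ▸ h.closedCycle_mul_star, hsum ▸ h.sum_mul_closedCycle, hsum ▸ h.closedCycle_mul_sum,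
    h.map_closedCycle hα, hsum ▸ h.closedCycle_pow, fun b hbe hbf hbg hVb k => ?_⟩
  exact IsCycled.closedCycle_intertwine
    (fun j l => (towerDiagonal_commute (hbe j) (hbf j) l).mul_right (hbg j))
    (towerAverage_intertwine hbe hVb) (star_towerAverage_intertwine he hV hbe hbg hVb) k

end Algebra

/-! ### The sequence algebra and lifting from it -/

section SequenceAlgebra

open Filter Topology BoundedContinuousFunction

variable (A : Type*) [CStarAlgebra A]

/-- Bounded sequences whose difference tends to zero. -/
def nullCon : RingCon (ℕ →ᵇ A) where
  r a b := Tendsto (fun m => a m - b m) atTop (𝓝 0)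
  iseqv :=
    { refl := fun a => by simp
      symm := fun {a b} h => by simpa using h.neg
      trans := fun {a b c} h h' => by simpa using h.add h' }
  add' {a b c d} h h' := by
    refine (by simpa using h.add h' : Tendsto _ _ _).congr fun m => ?_
    simp only [coe_add, Pi.add_apply]; abel
  mul' {a b c d} h h' := by
    have hb : ∀ u : ℕ →ᵇ A, IsBoundedUnder (· ≤ ·) atTop (norm ∘ (u : ℕ → A)) := fun u =>
      isBoundedUnder_of ⟨‖u‖, fun m => u.norm_coe_le_norm m⟩
    have h1 := NormedField.tendsto_zero_smul_of_tendsto_zero_of_bounded (𝕜 := ℝ)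
      (tendsto_zero_iff_norm_tendsto_zero.1 h) (hb c)
    have h2 := NormedField.tendsto_zero_smul_of_tendsto_zero_of_bounded (𝕜 := ℝ)
      (tendsto_zero_iff_norm_tendsto_zero.1 h') (hb b)
    have h3 := h1.norm.add h2.norm
    simp only [norm_zero, add_zero] at h3
    refine squeeze_zero_norm (fun m => ?_) h3
    have : (a * c) m - (b * d) m = (a m - b m) * c m + b m * (c m - d m) := by
      simp only [coe_mul, Pi.mul_apply]; noncomm_ring
    rw [this]
    refine (norm_add_le _ _).trans (add_le_add ?_ ?_)
    · simpa [norm_smul] using norm_mul_le (a m - b m) (c m)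
    · simpa [norm_smul, mul_comm] using norm_mul_le (b m) (c m - d m)

/-- Bounded sequences modulo null sequences. -/
abbrev SeqAlgebra : Type _ := (nullCon A).Quotient

variable {A}

/-- The class of a bounded sequence. -/
def seqMk : (ℕ →ᵇ A) →+* SeqAlgebra A := (nullCon A).mk'

lemma seqMk_surjective : Function.Surjective (seqMk (A := A)) := (nullCon A).mk'_surjective

lemma seqMk_eq_iff {a b : ℕ →ᵇ A} :
    seqMk a = seqMk b ↔ Tendsto (fun m => a m - b m) atTop (𝓝 0) := (nullCon A).eq

lemma seqMk_eq_of_le {a b : ℕ →ᵇ A} {δ : ℕ → ℝ} (hδ : Tendsto δ atTop (𝓝 0))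
    (h : ∀ᶠ m in atTop, ‖a m - b m‖ ≤ δ m) : seqMk a = seqMk b :=
  seqMk_eq_iff.2 (squeeze_zero_norm' h hδ)

lemma eventually_norm_sub_lt {a b : ℕ →ᵇ A} (h : seqMk a = seqMk b) {ε : ℝ} (hε : 0 < ε) :
    ∀ᶠ m in atTop, ‖a m - b m‖ < ε := by
  have := (seqMk_eq_iff.1 h).norm
  rw [norm_zero] at this
  exact this.eventually_lt_const hε

noncomputable instance : Star (SeqAlgebra A) where
  star := Quotient.map' star fun a b h => by
    have : Tendsto (fun m => star (a m - b m)) atTop (𝓝 0) := by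
      simpa using (show Tendsto (fun m => a m - b m) atTop (𝓝 0) from h).star
    exact this.congr fun m => by simp

lemma star_seqMk (a : ℕ →ᵇ A) : star (seqMk a) = seqMk (star a) := rfl

noncomputable instance : StarRing (SeqAlgebra A) where
  star_involutive x := by
    obtain ⟨a, rfl⟩ := seqMk_surjective x
    simp [star_seqMk]
  star_mul x y := by
    obtain ⟨a, rfl⟩ := seqMk_surjective x
    obtain ⟨b, rfl⟩ := seqMk_surjective y
    simp [star_seqMk, ← map_mul]
  star_add x y := by
    obtain ⟨a, rfl⟩ := seqMk_surjective x
    obtain ⟨b, rfl⟩ := seqMk_surjective y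
    simp [star_seqMk, ← map_add]

/-- The bounded sequence with the given terms. -/
noncomputable def bddSeq (a : ℕ → A) (C : ℝ) (h : ∀ m, ‖a m‖ ≤ C) : ℕ →ᵇ A :=
  ofNormedAddCommGroupDiscrete a C h

@[simp] lemma bddSeq_apply (a : ℕ → A) (C : ℝ) (h : ∀ m, ‖a m‖ ≤ C) (m : ℕ) :
    bddSeq a C h m = a m := rfl

/-- The termwise action of an automorphism on bounded sequences. -/
noncomputable def seqMap (β : A ≃⋆ₐ[ℂ] A) : (ℕ →ᵇ A) →+* (ℕ →ᵇ A) where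
  toFun a := bddSeq (fun m => β (a m)) ‖a‖ fun m => by
    rw [StarAlgEquiv.norm_map]; exact a.norm_coe_le_norm m
  map_one' := by ext m; simp
  map_mul' a b := by ext m; simp
  map_zero' := by ext m; simp
  map_add' a b := by ext m; simp

@[simp] lemma seqMap_apply (β : A ≃⋆ₐ[ℂ] A) (a : ℕ →ᵇ A) (m : ℕ) : seqMap β a m = β (a m) := rfl

/-- The action of an automorphism on the sequence algebra. -/
noncomputable def seqAut (β : A ≃⋆ₐ[ℂ] A) : SeqAlgebra A →+* SeqAlgebra A :=
  (nullCon A).lift (seqMk.comp (seqMap β)) fun a b h => by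
    refine seqMk_eq_iff.2 ?_
    refine squeeze_zero_norm (fun m => ?_)
      (tendsto_zero_iff_norm_tendsto_zero.1 (show Tendsto (fun m => a m - b m) atTop (𝓝 0) from h))
    rw [seqMap_apply, seqMap_apply, ← map_sub, StarAlgEquiv.norm_map]

lemma seqAut_seqMk (β : A ≃⋆ₐ[ℂ] A) (a : ℕ →ᵇ A) : seqAut β (seqMk a) = seqMk (seqMap β a) := rfl

lemma seqAut_star (β : A ≃⋆ₐ[ℂ] A) (x : SeqAlgebra A) :
    seqAut β (star x) = star (seqAut β x) := by
  obtain ⟨a, rfl⟩ := seqMk_surjective x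
  rw [star_seqMk, seqAut_seqMk, seqAut_seqMk, star_seqMk]
  congr 1
  ext m
  simp [map_star]

lemma seqAut_mul (β γ : A ≃⋆ₐ[ℂ] A) (x : SeqAlgebra A) :
    seqAut (β * γ) x = seqAut β (seqAut γ x) := by
  obtain ⟨a, rfl⟩ := seqMk_surjective x
  rfl

lemma seqAut_one (x : SeqAlgebra A) : seqAut 1 x = x := by
  obtain ⟨a, rfl⟩ := seqMk_surjective x
  rfl

/-- Projections of the sequence algebra lift to sequences of projections. -/
lemma exists_lift_isStarProjection {b : ℕ →ᵇ A} (hb : ∀ m, IsSelfAdjoint (b m))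
    (h : seqMk b * seqMk b = seqMk b) :
    ∃ p : ℕ →ᵇ A, (∀ m, IsStarProjection (p m)) ∧ seqMk p = seqMk b := by
  -- Where the defect is not yet small the default `0` is used; this affects only finitely many
  -- terms.
  have key : ∀ m, ∃ p : A, IsStarProjection p ∧
      (‖b m * b m - b m‖ < 1 / 4 → ‖p - b m‖ ≤ 2 * ‖b m * b m - b m‖) := fun m => by
    by_cases hm : ‖b m * b m - b m‖ < 1 / 4
    · obtain ⟨p, hp, hpb⟩ := exists_isStarProjection_near (hb m) hm le_rfl
      exact ⟨p, hp, fun _ => hpb⟩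
    · exact ⟨0, .zero A, fun h => absurd h hm⟩
  choose p hp hpb using key
  refine ⟨bddSeq p 1 fun m => (hp m).norm_le, hp, ?_⟩
  rw [← map_mul, seqMk_eq_iff] at h
  have h1 := h.norm
  rw [norm_zero] at h1
  refine seqMk_eq_of_le (δ := fun m => 2 * ‖b m * b m - b m‖) ?_ ?_
  · simpa using h1.const_mul 2
  · filter_upwards [h1.eventually_lt_const (show (0 : ℝ) < 1 / 4 by norm_num)] with m hm
    exact hpb m hm

/-- Unitaries of a corner of the sequence algebra lift to sequences of unitaries of corners. -/
lemma exists_lift_isUnitaryInCorner {p : ℕ →ᵇ A} (hp : ∀ m, IsStarProjection (p m))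
    {W : SeqAlgebra A} (h1 : star W * W = seqMk p) (h2 : W * star W = seqMk p)
    (h3 : seqMk p * W = W) (h4 : W * seqMk p = W) :
    ∃ w : ℕ →ᵇ A, seqMk w = W ∧ ∀ᶠ m in atTop, IsUnitaryInCorner (p m) (w m) := by
  obtain ⟨u, rfl⟩ := seqMk_surjective W
  -- Compressing the representative puts every term exactly in its corner without changing the
  -- class.
  set t := p * u * p with ht
  have htu : seqMk t = seqMk u := by rw [ht, map_mul, map_mul, h3, h4]
  rw [← htu] at h1 h2
  rw [star_seqMk, ← map_mul, seqMk_eq_iff] at h1 h2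
  have h1 := h1.norm
  have h2 := h2.norm
  set δ : ℕ → ℝ := fun m => ‖star (t m) * t m - p m‖ + ‖t m * star (t m) - p m‖ with hδ
  have hδ0 : Tendsto δ atTop (𝓝 0) := by simpa using h1.add h2
  have key : ∀ m, ∃ w : A, ‖w‖ ≤ 1 ∧
      (δ m < 1 / 16 → IsUnitaryInCorner (p m) w ∧ ‖w - t m‖ ≤ 4 * δ m) := fun m => by
    by_cases hm : δ m < 1 / 16
    · have hpp : p m * p m = p m := (hp m).isIdempotentElem
      obtain ⟨w, hw, hwt⟩ := exists_isUnitaryInCorner_near (hp m) (t := t m)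
        (by simp only [ht, coe_mul, Pi.mul_apply]
            rw [mul_assoc, mul_assoc, hpp, ← mul_assoc, ← mul_assoc, hpp]) hm.le
        (le_add_of_nonneg_right (norm_nonneg _)) (le_add_of_nonneg_left (norm_nonneg _))
      refine ⟨w, ?_, fun _ => ⟨hw, hwt⟩⟩
      have h5 : ‖w‖ * ‖w‖ ≤ 1 := by
        rw [← CStarRing.norm_star_mul_self, hw.2.1]; exact (hp m).norm_le
      nlinarith [norm_nonneg w]
    · exact ⟨0, by simp, fun h => absurd h hm⟩
  choose w hw1 hw using key
  have hev := hδ0.eventually_lt_const (show (0 : ℝ) < 1 / 16 by norm_num)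
  refine ⟨bddSeq w 1 hw1, ?_, ?_⟩
  · rw [← htu]
    refine seqMk_eq_of_le (δ := fun m => 4 * δ m) (by simpa using hδ0.const_mul 4) ?_
    filter_upwards [hev] with m hm
    exact (hw m hm).2
  · filter_upwards [hev] with m hm
    exact (hw m hm).1

end SequenceAlgebra

/-! ### The automorphisms indexed by `ZMod n` -/

section Cyclic

variable {A : Type*} [CStarAlgebra A] {n : ℕ} [NeZero n] {α : A ≃⋆ₐ[ℂ] A}

/-- The automorphism by which the class `k` acts. -/
def cyclicAut (hα : α ^ n = 1) (k : ZMod n) : A ≃⋆ₐ[ℂ] A :=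
  cyclicAction n α hα (Multiplicative.ofAdd k)

variable (hα : α ^ n = 1)

lemma cyclicAut_natCast (i : ℕ) : cyclicAut hα (i : ZMod n) = α ^ i := by
  change α ^ (ZMod.val (i : ZMod n)) = α ^ i
  rw [ZMod.val_natCast]
  exact (pow_eq_pow_mod _ hα).symm

lemma cyclicAut_zero : cyclicAut hα 0 = 1 := by
  simpa using cyclicAut_natCast hα 0

lemma cyclicAut_one : cyclicAut hα 1 = α := by
  simpa using cyclicAut_natCast hα 1

lemma cyclicAut_add (j k : ZMod n) : cyclicAut hα (j + k) = cyclicAut hα j * cyclicAut hα k := by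
  simp [cyclicAut, ofAdd_add]

lemma cyclicAut_add_one (k : ZMod n) : cyclicAut hα (k + 1) = α * cyclicAut hα k := by
  rw [add_comm, cyclicAut_add, cyclicAut_one]

end Cyclic

lemma zmod_induction {n : ℕ} [NeZero n] {p : ZMod n → Prop} (h0 : p 0)
    (h1 : ∀ k, p k → p (k + 1)) (k : ZMod n) : p k := by
  have : ∀ i : ℕ, p (i : ZMod n) := fun i => by
    induction i with
    | zero => simpa using h0
    | succ i ih => simpa using h1 _ ih
  simpa using this k.val

/-! ### Choosing the towers and the implementing unitary -/

section ApproxData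

variable {A : Type*} [CStarAlgebra A]

/-- Two approximate towers and an approximately implementing unitary of a corner, each
approximately commuting with the data chosen before. -/
structure ApproxData {n : ℕ} [NeZero n] {α : A ≃⋆ₐ[ℂ] A} (hα : α ^ n = 1) (F : Finset A) (δ : ℝ)
    (x y₁ y₂ y₃ : A) (e : ZMod n → A) (g v : A) (f : ZMod n → A) : Prop where
  proj_e : ∀ k, IsStarProjection (e k)
  orth_e : ∀ j k, j ≠ k → e j * e k = 0
  map_e : ∀ k, ‖α (e k) - e (k + 1)‖ < δ
  comm_e : ∀ k, ∀ a ∈ F, ‖e k * a - a * e k‖ < δ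
  proj_g : IsStarProjection g
  unitary : IsUnitaryInCorner g v
  map_g : ‖α g - g‖ < δ
  comm_g : ∀ a ∈ F, ‖g * a - a * g‖ < δ
  comm_ge : ∀ k, ‖g * e k - e k * g‖ < δ
  impl : ∀ a ∈ F, ‖v * (g * a * g) * star v - α (g * a * g)‖ < δ
  impl_e : ∀ k, ‖v * (g * e k * g) * star v - α (g * e k * g)‖ < δ
  proj_f : ∀ k, IsStarProjection (f k)
  orth_f : ∀ j k, j ≠ k → f j * f k = 0
  map_f : ∀ k, ‖α (f k) - f (k + 1)‖ < δ
  comm_f : ∀ k, ∀ a ∈ F, ‖f k * a - a * f k‖ < δ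
  comm_fe : ∀ j k, ‖f j * e k - e k * f j‖ < δ
  comm_fg : ∀ k, ‖f k * g - g * f k‖ < δ
  comm_fv : ∀ j k, ‖f j * cyclicAut hα k v - cyclicAut hα k v * f j‖ < δ
  equiv_e : EquivToProjIn (1 - ∑ k, e k) y₁
  equiv_g : EquivToProjIn (1 - g) y₂
  equiv_f : EquivToProjIn (1 - ∑ k, f k) y₃
  norm_lt : (1 - δ) ^ 6 * ‖x‖ <
    ‖(∑ k, f k) * (g * ((∑ k, e k) * x * ∑ k, e k) * g) * ∑ k, f k‖

variable [PartialOrder A] [StarOrderedRing A] {n : ℕ} [NeZero n] {α : A ≃⋆ₐ[ℂ] A}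

lemma TracialRokhlinProperty.exists_cyclic_towers {hα : α ^ n = 1}
    (h : TracialRokhlinProperty (cyclicAction n α hα)) (hA : IsSimpleCStar A)
    (F : Finset A) {δ : ℝ} (hδ : 0 < δ) (hδ1 : δ < 1) {x y : A} (hx : 0 ≤ x) (hx0 : x ≠ 0)
    (hy : 0 ≤ y) (hy0 : y ≠ 0) :
    ∃ e : ZMod n → A,
      (∀ k, IsStarProjection (e k)) ∧
      (∀ j k, j ≠ k → e j * e k = 0) ∧
      (∀ k, ‖α (e k) - e (k + 1)‖ < δ) ∧
      (∀ k, ∀ a ∈ F, ‖e k * a - a * e k‖ < δ) ∧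
      EquivToProjIn (1 - ∑ k, e k) y ∧
      (1 - δ) ^ 2 * ‖x‖ < ‖(∑ k, e k) * x * (∑ k, e k)‖ := by
  obtain ⟨e, h1, h2, h3, h4, h5, h6⟩ := h.exists_towers hA F hδ hδ1 hx hx0 hy hy0
  rw [← Equiv.sum_comp Multiplicative.ofAdd e] at h5 h6
  refine ⟨fun k => e (Multiplicative.ofAdd k), fun k => h1 _, fun j k hjk => h2 _ _ hjk,
    fun k => ?_, fun k => h4 _, h5, h6⟩
  have := h3 (Multiplicative.ofAdd 1) (Multiplicative.ofAdd k)
  rw [← ofAdd_add, add_comm] at this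
  rwa [show cyclicAction n α hα (Multiplicative.ofAdd 1) = α from cyclicAut_one hα] at this

/-- The order of choice matters: each object must almost commute with the earlier ones, and `f` also
with all translates of `v`. Each stage is applied to `x` compressed by the earlier stages, nonzero
by their norm estimates, and costs a factor `(1 - δ)^2`. -/
lemma exists_approxData {hα : α ^ n = 1} (hinn : StronglyTraciallyApproxInner α)
    (hTRP : TracialRokhlinProperty (cyclicAction n α hα)) (hA : IsSimpleCStar A)
    (F : Finset A) {δ : ℝ} (hδ : 0 < δ) (hδ1 : δ < 1) {x y₁ y₂ y₃ : A} (hx : 0 ≤ x) (hx0 : x ≠ 0)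
    (hy₁ : 0 ≤ y₁) (hy₁0 : y₁ ≠ 0) (hy₂ : 0 ≤ y₂) (hy₂0 : y₂ ≠ 0) (hy₃ : 0 ≤ y₃) (hy₃0 : y₃ ≠ 0) :
    ∃ e g v f, ApproxData hα F δ x y₁ y₂ y₃ e g v f := by
  classical
  have hδ' : 0 < 1 - δ := by linarith
  obtain ⟨e, he1, he2, he3, he4, he5, he6⟩ :=
    hTRP.exists_cyclic_towers hA F hδ hδ1 hx hx0 hy₁ hy₁0
  have hE := isStarProjection_sum he1 he2
  set E := ∑ k, e k with hEd
  have hx' : 0 ≤ E * x * E := by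
    simpa [hE.isSelfAdjoint.star_eq] using star_left_conjugate_nonneg hx E
  have hx'0 : E * x * E ≠ 0 := norm_pos_iff.1 (lt_of_le_of_lt (by positivity) he6)
  obtain ⟨g, v, hg1, hg2, hg3, hg4, hg5, hg6, hg7⟩ :=
    hinn.exists_unitary hA (F ∪ Finset.univ.image e) hδ hδ1 hx' hx'0 hy₂ hy₂0
  have hx'' : 0 ≤ g * (E * x * E) * g := by
    simpa [hg1.isSelfAdjoint.star_eq] using star_left_conjugate_nonneg hx' g
  have hx''0 : g * (E * x * E) * g ≠ 0 := norm_pos_iff.1 (lt_of_le_of_lt (by positivity) hg7)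
  obtain ⟨f, hf1, hf2, hf3, hf4, hf5, hf6⟩ := hTRP.exists_cyclic_towers hA
    (F ∪ Finset.univ.image e ∪ {g} ∪ Finset.univ.image fun k => cyclicAut hα k v)
    hδ hδ1 hx'' hx''0 hy₃ hy₃0
  refine ⟨e, g, v, f, he1, he2, he3, he4, hg1, hg2, hg3, fun a ha => hg4 a (by simp [ha]),
    fun k => hg4 _ (by simp), fun a ha => hg5 a (by simp [ha]), fun k => hg5 _ (by simp),
    hf1, hf2, hf3, fun k a ha => hf4 k a (by simp [ha]), fun j k => hf4 j _ (by simp),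
    fun k => hf4 k _ (by simp), fun j k => hf4 j _ (by simp), he5, hg6, hf5, ?_⟩
  refine lt_trans ?_ hf6
  calc (1 - δ) ^ 6 * ‖x‖ = (1 - δ) ^ 4 * ((1 - δ) ^ 2 * ‖x‖) := by ring
    _ < (1 - δ) ^ 4 * ‖E * x * E‖ := by gcongr
    _ = (1 - δ) ^ 2 * ((1 - δ) ^ 2 * ‖E * x * E‖) := by ring
    _ < _ := by gcongr

/-- Adding up three comparisons with orthogonal elements. -/
lemma exists_sum_comparison {E g Q x y₁ y₂ y₃ : A} (hE : IsStarProjection E)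
    (hg : IsStarProjection g) (hQ : IsStarProjection Q)
    (hy₁ : 0 ≤ y₁) (hy₂ : 0 ≤ y₂) (hy₃ : 0 ≤ y₃) (h12 : y₁ * y₂ = 0) (h13 : y₁ * y₃ = 0)
    (h23 : y₂ * y₃ = 0) (hx₁ : ∃ b, y₁ = x * b) (hx₂ : ∃ b, y₂ = x * b) (hx₃ : ∃ b, y₃ = x * b)
    (h1 : EquivToProjIn (1 - E) y₁) (h2 : EquivToProjIn (1 - g) y₂)
    (h3 : EquivToProjIn (1 - Q) y₃) :
    ∃ s ∈ closedRightIdeal x, star s * s = 1 - E * g * Q * g * E := by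
  have hx : ∀ {y}, (∃ b, y = x * b) → closedRightIdeal y ⊆ closedRightIdeal x := fun ⟨b, hb⟩ =>
    closedRightIdeal_subset (hb ▸ mul_mem_closedRightIdeal x b)
  rw [equivToProjIn_iff hE.one_sub hy₁.isSelfAdjoint] at h1
  rw [equivToProjIn_iff hg.one_sub hy₂.isSelfAdjoint] at h2
  rw [equivToProjIn_iff hQ.one_sub hy₃.isSelfAdjoint] at h3
  obtain ⟨u, hu, huE⟩ := h1
  obtain ⟨v, hv, hvg⟩ := h2
  obtain ⟨w, hw, hwQ⟩ := h3
  have orth : ∀ {a b c d : A}, 0 ≤ a → a * b = 0 → c ∈ closedRightIdeal a →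
      d ∈ closedRightIdeal b → star c * d = 0 := fun ha hab hc hd =>
    star_mul_eq_zero_of_orthogonal (by rw [ha.isSelfAdjoint.star_eq, hab]) hc hd
  have uv := orth hy₁ h12 hu hv
  have uw := orth hy₁ h13 hu hw
  have vw := orth hy₂ h23 hv hw
  have vu : star v * u = 0 := by simpa using congrArg star uv
  have wu : star w * u = 0 := by simpa using congrArg star uw
  have wv : star w * v = 0 := by simpa using congrArg star vw
  have hEs : star E = E := hE.isSelfAdjoint
  have hgs : star g = g := hg.isSelfAdjoint
  have hEE : E * E = E := hE.isIdempotentElem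
  have hgg : g * g = g := hg.isIdempotentElem
  -- The cross terms vanish by orthogonality, and the squares telescope: `(1-E) + E(1-g)E +
  -- Eg(1-Q)gE`.
  refine ⟨u + v * E + w * (g * E), closedRightIdeal_add_mem (closedRightIdeal_add_mem (hx hx₁ hu)
    (closedRightIdeal_mul_mem (hx hx₂ hv) _)) (closedRightIdeal_mul_mem (hx hx₃ hw) _), ?_⟩
  calc star (u + v * E + w * (g * E)) * (u + v * E + w * (g * E))
      = star u * u + star u * v * E + star u * w * (g * E) + E * (star v * u)
        + E * (star v * v) * E + E * (star v * w) * (g * E) + E * g * (star w * u)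
        + E * g * (star w * v) * E + E * g * (star w * w) * (g * E) := by
        simp only [star_add, star_mul, hEs, hgs]; noncomm_ring
    _ = (1 - E) + (E * E - E * g * E) + (E * (g * g) * E - E * g * Q * g * E) := by
        rw [uv, uw, vw, vu, wu, wv, huE, hvg, hwQ]; noncomm_ring
    _ = _ := by rw [hEE, hgg]; abel

end ApproxData

/-! ### From approximate data to an exact cyclic unitary -/

section Limit

open Filter Topology BoundedContinuousFunction

/-- Turns approximate innerness, stated for compressions by `g`, into an intertwining relation:
multiply on the right by `v` and absorb `g`, which commutes with `c` and `c'`. -/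
lemma intertwine_of_conj {R : Type*} [Ring R] {g v v' c c' : R} (hg : g * g = g)
    (hv : v' * v = g) (hgv : g * v = v) (hvg : v * g = v) (hc : g * c = c * g)
    (hc' : g * c' = c' * g) (h : v * (g * c * g) * v' = g * c' * g) : v * c = c' * v := by
  have h1 : v * c = v * (g * c * g) * v' * v := by
    rw [mul_assoc, hv, mul_assoc, mul_assoc, mul_assoc, hg, ← mul_assoc, hvg, ← hc, ← mul_assoc,
      hvg]
  rw [h1, h, mul_assoc, hgv, hc', mul_assoc, hgv]

variable {A : Type*} [CStarAlgebra A] {n : ℕ} [NeZero n] {α : A ≃⋆ₐ[ℂ] A} {hα : α ^ n = 1}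

lemma seqAut_cyclicAut_succ (k : ZMod n) (s : SeqAlgebra A) :
    seqAut (cyclicAut hα (k + 1)) s = seqAut α (seqAut (cyclicAut hα k) s) := by
  rw [cyclicAut_add_one, seqAut_mul]

lemma seqAut_cyclicAut_zero (s : SeqAlgebra A) : seqAut (cyclicAut hα (0 : ZMod n)) s = s := by
  rw [cyclicAut_zero, seqAut_one]

lemma seqAut_cyclicAut_fixed {s : SeqAlgebra A} (hs : seqAut α s = s) (k : ZMod n) :
    seqAut (cyclicAut hα k) s = s := by
  induction k using zmod_induction with
  | h0 => exact seqAut_cyclicAut_zero s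
  | h1 k ih => rw [seqAut_cyclicAut_succ, ih, hs]

/-- The class of a constant sequence. -/
noncomputable def seqConst (a : A) : SeqAlgebra A := seqMk (const ℕ a)

lemma seqAut_seqConst (β : A ≃⋆ₐ[ℂ] A) (a : A) : seqAut β (seqConst a) = seqConst (β a) := rfl

/-- Sequences of approximate data with errors tending to zero produce an exact cyclic unitary in
the sequence algebra. -/
lemma exists_cyclic_unitary_seqAlgebra {F : Finset A} {δ : ℕ → ℝ}
    (hδ : Tendsto δ atTop (𝓝 0)) {x y₁ y₂ y₃ : A}
    (hF : ∀ a ∈ F, ∀ k, cyclicAut hα k a ∈ F)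
    {e f : ℕ → ZMod n → A} {g v : ℕ → A}
    (D : ∀ m, ApproxData hα F (δ m) x y₁ y₂ y₃ (e m) (g m) (v m) (f m)) :
    ∃ (z : ℕ →ᵇ A) (q W : SeqAlgebra A), (∀ m, z m = (∑ k, e m k) * g m * ∑ k, f m k) ∧
      q = seqMk z ∧ star q = q ∧ q * q = q ∧
      star W * W = q ∧ W * star W = q ∧ q * W = W ∧ W * q = W ∧ seqAut α W = W ∧ W ^ n = q ∧
      (∀ a ∈ F, q * seqConst a = seqConst a * q) ∧
      ∀ a ∈ F, ∀ i : ℕ, W ^ i * seqConst a = seqConst (cyclicAut hα i a) * W ^ i := by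
  have bound_of_unitary : ∀ {q w : A}, IsStarProjection q → IsUnitaryInCorner q w → ‖w‖ ≤ 1 := by
    intro q w hq hw
    have : ‖w‖ * ‖w‖ ≤ 1 := by rw [← CStarRing.norm_star_mul_self, hw.2.1]; exact hq.norm_le
    nlinarith [norm_nonneg w]
  let es : ZMod n → ℕ →ᵇ A := fun k => bddSeq (fun m => e m k) 1 fun m => ((D m).proj_e k).norm_le
  let fs : ZMod n → ℕ →ᵇ A := fun k => bddSeq (fun m => f m k) 1 fun m => ((D m).proj_f k).norm_le
  let gs : ℕ →ᵇ A := bddSeq g 1 fun m => (D m).proj_g.norm_le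
  let vs : ℕ →ᵇ A := bddSeq v 1 fun m => bound_of_unitary (D m).proj_g (D m).unitary
  let V : ZMod n → SeqAlgebra A := fun k => seqAut (cyclicAut hα k) (seqMk vs)
  have comm : ∀ {a b : ℕ →ᵇ A}, (∀ m, ‖a m * b m - b m * a m‖ < δ m) →
      seqMk a * seqMk b = seqMk b * seqMk a := fun {a b} h => by
    rw [← map_mul, ← map_mul]
    exact seqMk_eq_of_le hδ (.of_forall fun m => (h m).le)
  have tower : ∀ {c : ℕ → ZMod n → A} (hc : ∀ m k, IsStarProjection (c m k)),
      (∀ m j k, j ≠ k → c m j * c m k = 0) → (∀ m k, ‖α (c m k) - c m (k + 1)‖ < δ m) →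
      IsTower (seqAut α) fun k => seqMk (bddSeq (fun m => c m k) 1 fun m => (hc m k).norm_le) := by
    intro c hc ho hm
    refine ⟨fun k => ?_, fun k => ?_, fun j k hjk => ?_, fun k => ?_⟩
    · rw [star_seqMk]; congr 1; ext m; exact (hc m k).isSelfAdjoint
    · rw [← map_mul]; congr 1; ext m; exact (hc m k).isIdempotentElem
    · rw [← map_mul, ← map_zero seqMk]; congr 1; ext m; exact ho m j k hjk
    · rw [seqAut_seqMk]; exact seqMk_eq_of_le hδ (.of_forall fun m => (hm m k).le)
  have he : IsTower (seqAut α) fun k => seqMk (es k) :=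
    tower (fun m => (D m).proj_e) (fun m => (D m).orth_e) fun m => (D m).map_e
  have hf : IsTower (seqAut α) fun k => seqMk (fs k) :=
    tower (fun m => (D m).proj_f) (fun m => (D m).orth_f) fun m => (D m).map_f
  have hgstar : star (seqMk gs) = seqMk gs := by
    rw [star_seqMk]; congr 1; ext m; exact (D m).proj_g.isSelfAdjoint
  have hgg : seqMk gs * seqMk gs = seqMk gs := by
    rw [← map_mul]; congr 1; ext m; exact (D m).proj_g.isIdempotentElem
  have hgmap : seqAut α (seqMk gs) = seqMk gs := by
    rw [seqAut_seqMk]; exact seqMk_eq_of_le hδ (.of_forall fun m => (D m).map_g.le)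
  have hgfix := fun k => seqAut_cyclicAut_fixed (hα := hα) hgmap k
  have hvv : seqMk vs * star (seqMk vs) = seqMk gs := by
    rw [star_seqMk, ← map_mul]; congr 1; ext m; exact (D m).unitary.2.2
  have hvv' : star (seqMk vs) * seqMk vs = seqMk gs := by
    rw [star_seqMk, ← map_mul]; congr 1; ext m; exact (D m).unitary.2.1
  have hvg : seqMk vs * seqMk gs = seqMk vs := by
    rw [← map_mul]; congr 1; ext m
    exact mul_eq_self_of_star_mul_eq (D m).proj_g (D m).unitary.2.1
  have hgv : seqMk gs * seqMk vs = seqMk vs := by rw [← hvv, mul_assoc, hvv', hvg]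
  have hVmap : ∀ k, seqAut α (V k) = V (k + 1) := fun k => (seqAut_cyclicAut_succ k _).symm
  have impl : ∀ {c : ℕ →ᵇ A}, seqMk gs * seqMk c = seqMk c * seqMk gs →
      (∀ m, ‖v m * (g m * c m * g m) * star (v m) - α (g m * c m * g m)‖ < δ m) →
      seqMk vs * seqMk c = seqAut α (seqMk c) * seqMk vs := by
    intro c hc h
    refine intertwine_of_conj hgg hvv' hgv hvg hc ?_ ?_
    · have := congrArg (seqAut α) hc
      simpa only [map_mul, hgmap] using this
    · have : seqMk vs * (seqMk gs * seqMk c * seqMk gs) * star (seqMk vs)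
          = seqAut α (seqMk gs * seqMk c * seqMk gs) := by
        rw [star_seqMk, ← map_mul, ← map_mul, ← map_mul, ← map_mul, seqAut_seqMk]
        exact seqMk_eq_of_le hδ (.of_forall fun m => (h m).le)
      rw [this, map_mul, map_mul, hgmap]
  -- Applying `α` to the relation for `V j` and `b (k - 1)` gives the one for `V (j + 1)` and `b k`.
  have spread : ∀ {b : ZMod n → SeqAlgebra A}, (∀ k, seqAut α (b k) = b (k + 1)) →
      (∀ k, seqMk vs * b k = seqAut α (b k) * seqMk vs) → ∀ j k, V j * b k = b (k + 1) * V j := by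
    intro b hb h j
    induction j using zmod_induction with
    | h0 => intro k; rw [show V 0 = seqMk vs from seqAut_cyclicAut_zero _, h, hb]
    | h1 j ih =>
      intro k
      have := congrArg (seqAut α) (ih (k - 1))
      simpa only [map_mul, hVmap, hb, sub_add_cancel] using this
  have hge : ∀ k, seqMk gs * seqMk (es k) = seqMk (es k) * seqMk gs := fun k =>
    comm fun m => (D m).comm_ge k
  have hV : IsShift (seqAut α) (seqMk gs) (fun k => seqMk (es k)) V := by
    refine ⟨hgstar, hgg, hgmap, hge, hVmap, fun k => ?_, fun k => ?_, fun k => ?_,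
      spread he.map fun k => impl (hge k) fun m => (D m).impl_e k⟩
    · rw [← seqAut_star, ← map_mul, hvv, hgfix]
    · rw [← seqAut_star, ← map_mul, hvv', hgfix]
    · nth_rw 1 [← hgfix k]
      rw [← map_mul, hvg]
  have hfe : ∀ j k, Commute (seqMk (fs j)) (seqMk (es k)) := fun j k =>
    comm fun m => (D m).comm_fe j k
  have hfg : ∀ k, Commute (seqMk (fs k)) (seqMk gs) := fun k => comm fun m => (D m).comm_fg k
  have hfV : ∀ j k, Commute (seqMk (fs j)) (V k) := fun j k => comm fun m => (D m).comm_fv j k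
  let z : ℕ →ᵇ A := (∑ k, es k) * gs * ∑ k, fs k
  have hz : seqMk z = (∑ k, seqMk (es k)) * seqMk gs * ∑ k, seqMk (fs k) := by
    simp only [z, map_mul, map_sum]
  obtain ⟨hq1, hq2, W, h1, h2, h3, h4, h5, h6, h7⟩ :=
    exists_cyclic_unitary (seqAut_star α) he hf hV hfe hfg hfV hz
  have hce : ∀ a ∈ F, ∀ k, Commute (seqConst a) (seqMk (es k)) := fun a ha k =>
    (comm fun m => (D m).comm_e k a ha).symm
  have hcf : ∀ a ∈ F, ∀ k, Commute (seqConst a) (seqMk (fs k)) := fun a ha k =>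
    (comm fun m => (D m).comm_f k a ha).symm
  have hcg : ∀ a ∈ F, Commute (seqConst a) (seqMk gs) := fun a ha =>
    (comm fun m => (D m).comm_g a ha).symm
  have hbmap : ∀ a k, seqAut α (seqConst (cyclicAut hα k a)) = seqConst (cyclicAut hα (k + 1) a) :=
    fun a k => by rw [seqAut_seqConst, cyclicAut_add_one]; rfl
  refine ⟨z, seqMk z, W, fun m => ?_, rfl, hq1, hq2, h1, h2, h3, h4, h5, h6, fun a ha => ?_,
    fun a ha i => ?_⟩
  · simp [z, es, fs, gs]
  · rw [hz]
    exact (((Commute.sum_right _ _ _ fun k _ => hce a ha k).mul_right (hcg a ha)).mul_right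
      (Commute.sum_right _ _ _ fun k _ => hcf a ha k)).eq.symm
  -- The family `b` is the orbit of `a`, which is why `F` must be invariant.
  · have key := h7 (fun k => seqConst (cyclicAut hα k a)) (fun j => hce _ (hF a ha j))
      (fun j => hcf _ (hF a ha j)) (fun k => hcg _ (hF a ha k))
      (spread (hbmap a) fun k => impl (hcg _ (hF a ha k)).eq.symm
        fun m => (D m).impl _ (hF a ha k))
    induction i with
    | zero => simp [cyclicAut_zero]
    | succ i ih =>
      rw [pow_succ', mul_assoc, ih, ← mul_assoc, key, mul_assoc]
      push_cast
      rfl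

end Limit

/-! ### Lifting the representation to `A` -/

section Main

open Filter Topology BoundedContinuousFunction

/-- The factor `p` matters only for `i = 0`, where the power is `1` rather than the unit of the
corner. -/
lemma IsUnitaryInCorner.pow_mul {A : Type*} [CStarAlgebra A] {p w : A} (hp : IsStarProjection p)
    (hw : IsUnitaryInCorner p w) (i : ℕ) : IsUnitaryInCorner p (w ^ i * p) := by
  have hpp : p * p = p := hp.isIdempotentElem
  have hps : star p = p := hp.isSelfAdjoint
  have hwp : w * p = w := mul_eq_self_of_star_mul_eq hp hw.2.1
  have hpw : p * w = w := by rw [← hw.2.2, mul_assoc, hw.2.1, hwp]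
  have hws : star w * p = star w := by simpa [hps] using congrArg star hpw
  induction i with
  | zero => exact ⟨⟨1, by simp [hpp]⟩, by simp [hps, hpp], by simp [hps, hpp]⟩
  | succ i ih =>
    obtain ⟨⟨a, ha⟩, h1, h2⟩ := ih
    rw [pow_succ', mul_assoc]
    refine ⟨⟨w * (w ^ i * p), ?_⟩, ?_, ?_⟩
    · rw [← mul_assoc p, hpw, mul_assoc w, mul_assoc _ p p, hpp]
    · have h3 : p * (w ^ i * p) = w ^ i * p := by rw [ha, ← mul_assoc, ← mul_assoc, hpp]
      rw [star_mul, mul_assoc, ← mul_assoc (star w), hw.2.1, h3, h1]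
    · rw [star_mul, mul_assoc, ← mul_assoc _ _ (star w), h2, ← mul_assoc, hwp, hw.2.2]

lemma corner_pow_mul_star {R : Type*} [Ring R] [StarRing R] {q W : R} (hqs : star q = q)
    (hqq : q * q = q) (hWq : W * q = W) (hWW : W * star W = q) (i : ℕ) :
    W ^ i * q * star (W ^ i * q) = q := by
  induction i with
  | zero => simp [hqs, hqq]
  | succ i ih =>
    have : W ^ (i + 1) * q = W * (W ^ i * q) := by rw [pow_succ', mul_assoc]
    rw [this, star_mul, mul_assoc, ← mul_assoc _ _ (star W), ih, ← mul_assoc, hWq, hWW]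

lemma corner_conj_eq {R : Type*} [Ring R] [StarRing R] {q W b c : R} (hqs : star q = q)
    (hqq : q * q = q) (hWq : W * q = W) (hWW : W * star W = q) (hb : q * b = b * q)
    (hc : q * c = c * q) {i : ℕ} (hbc : W ^ i * b = c * W ^ i) :
    q * c * q = W ^ i * q * (q * b * q) * star (W ^ i * q) := by
  have h1 : q * (q * b * q) = b * q * q := by
    rw [← mul_assoc, ← mul_assoc, hqq, hb]
  calc q * c * q = c * (W ^ i * q * star (W ^ i * q)) := by
        rw [corner_pow_mul_star hqs hqq hWq hWW, hc, mul_assoc, hqq]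
    _ = c * W ^ i * (q * star (W ^ i * q)) := by noncomm_ring
    _ = W ^ i * (b * (q * q)) * star (W ^ i * q) := by rw [← hbc, hqq]; noncomm_ring
    _ = W ^ i * (q * (q * b * q)) * star (W ^ i * q) := by rw [h1, mul_assoc b]
    _ = _ := by noncomm_ring

variable {A : Type*} [CStarAlgebra A] [PartialOrder A] [StarOrderedRing A]

theorem traciallyApproxRepresentable_cyclicAction
    (hinf : ¬ FiniteDimensional ℂ A) (hA : IsSimpleCStar A)
    (n : ℕ) [NeZero n] (α : A ≃⋆ₐ[ℂ] A) (hα : α ^ n = 1)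
    (hinn : StronglyTraciallyApproxInner α)
    (hTRP : TracialRokhlinProperty (cyclicAction n α hα)) :
    TraciallyApproxRepresentable (cyclicAction n α hα) := by
  classical
  intro F ε hε x hx hx1
  have hx0 : x ≠ 0 := by rintro rfl; simp at hx1
  obtain ⟨y₁, y₂, y₃, hy₁, hy₂, hy₃, hy₁0, hy₂0, hy₃0, h12, h13, h23, hx₁, hx₂, hx₃⟩ :=
    hA.exists_three_orthogonal hinf hx hx0
  set F' : Finset A := (F ×ˢ (Finset.univ : Finset (ZMod n))).image
    fun p => cyclicAut hα p.2 p.1 with hF'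
  have hFF' : ∀ a ∈ F, a ∈ F' := fun a ha =>
    Finset.mem_image.2 ⟨(a, 0), by simp [ha], by simp [cyclicAut_zero]⟩
  have hF'inv : ∀ a ∈ F', ∀ k, cyclicAut hα k a ∈ F' := by
    intro a ha k
    obtain ⟨⟨b, j⟩, hb, rfl⟩ := Finset.mem_image.1 ha
    refine Finset.mem_image.2 ⟨(b, k + j), by simpa using hb, ?_⟩
    simp only [cyclicAut_add]; rfl
  -- The shift by `2` keeps `δ 0` below `1`.
  let δ : ℕ → ℝ := fun m => 1 / ((m : ℝ) + 2)
  have hδ0 : ∀ m, 0 < δ m := fun m => by positivity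
  have hδ1 : ∀ m, δ m < 1 := fun m => by
    rw [div_lt_one (by positivity)]; have : (0 : ℝ) ≤ m := m.cast_nonneg; linarith
  have hδ : Tendsto δ atTop (𝓝 0) := by
    refine Tendsto.div_atTop tendsto_const_nhds ?_
    exact tendsto_atTop_add_const_right _ _ tendsto_natCast_atTop_atTop
  choose e g v f D using fun m => exists_approxData hinn hTRP hA F' (hδ0 m) (hδ1 m) hx hx0
    hy₁ hy₁0 hy₂ hy₂0 hy₃ hy₃0
  obtain ⟨z, q, W, hz, hqz, hqs, hqq, hW1, hW2, hW3, hW4, hW5, hW6, hqF, hWF⟩ :=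
    exists_cyclic_unitary_seqAlgebra hδ hF'inv D
  have hE := fun m => isStarProjection_sum (D m).proj_e (D m).orth_e
  have hQ := fun m => isStarProjection_sum (D m).proj_f (D m).orth_f
  -- The terms `E g Q` of `z` need not be selfadjoint; `z z⋆` is a selfadjoint representative of
  -- `q`, in the form required by `exists_sum_comparison`.
  have hzs : ∀ m, (z * star z) m = (∑ k, e m k) * g m * (∑ k, f m k) * g m * ∑ k, e m k := by
    intro m
    have hQQ : (∑ k, f m k) * (∑ k, f m k) = ∑ k, f m k := (hQ m).isIdempotentElem
    rw [coe_mul, Pi.mul_apply, star_apply, hz, star_mul, star_mul, (hE m).isSelfAdjoint.star_eq,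
      (hQ m).isSelfAdjoint.star_eq, (D m).proj_g.isSelfAdjoint.star_eq,
      ← mul_assoc, mul_assoc _ (∑ k, f m k) (∑ k, f m k), hQQ, ← mul_assoc]
  have hqz' : seqMk (z * star z) = q := by
    rw [map_mul, ← star_seqMk, ← hqz, hqs, hqq]
  obtain ⟨p, hp, hpz⟩ := exists_lift_isStarProjection (b := z * star z)
    (fun m => IsSelfAdjoint.mul_star_self (z m)) (by rw [hqz', hqq])
  have hpq : seqMk p = q := hpz.trans hqz'
  rw [← hpq] at hW1 hW2 hW3 hW4
  obtain ⟨w, hwW, hw⟩ := exists_lift_isUnitaryInCorner hp hW1 hW2 hW3 hW4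
  rw [hpq] at hW1 hW2 hW3 hW4
  have hαq : seqAut α q = q := by rw [← hW6, map_pow, hW5]
  have hqW : ∀ i, q * W ^ i = W ^ i * q := fun i => by
    have : Commute q W := by rw [Commute, SemiconjBy, hW3, hW4]
    exact (this.pow_right i).eq
  have rel1 : ∀ a ∈ F, seqMk (p * const ℕ a) = seqMk (const ℕ a * p) := fun a ha => by
    rw [map_mul, map_mul, hpq]; exact hqF a (hFF' a ha)
  have rel2 : ∀ a ∈ F, ∀ i : ℕ, seqMk (seqMap (cyclicAut hα i) (p * const ℕ a * p))
      = seqMk (w ^ i * p * (p * const ℕ a * p) * star (w ^ i * p)) := fun a ha i => by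
    rw [← seqAut_seqMk]
    simp only [map_mul, map_pow, ← star_seqMk, hpq, hwW]
    rw [seqAut_cyclicAut_fixed hαq]
    change q * seqConst (cyclicAut hα i a) * q = W ^ i * q * (q * seqConst a * q) * _
    exact corner_conj_eq hqs hqq hW4 hW2 (hqF a (hFF' a ha)) (hqF _ (hF'inv a (hFF' a ha) i))
      (hWF a (hFF' a ha) i)
  have rel3 : ∀ j k : ZMod n, seqMk (w ^ j.val * p * (w ^ k.val * p))
      = seqMk (w ^ (j + k).val * p) := fun j k => by
    simp only [map_mul, map_pow, hpq, hwW]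
    rw [mul_assoc, ← mul_assoc q, hqW, mul_assoc _ q q, hqq, ← mul_assoc, ← pow_add, ZMod.val_add]
    -- Exponents are representatives in `[0, n)`; a carry in `j + k` is absorbed by `W ^ n = q`.
    have hper : ∀ t, W ^ (n * t) * q = q := fun t => by
      induction t with
      | zero => simp
      | succ t ih => rw [mul_add, mul_one, pow_add, mul_assoc, hW6, hqq, ih]
    nth_rw 1 [← Nat.mod_add_div (j.val + k.val) n]
    rw [pow_add, mul_assoc, hper]
  have rel4 : ∀ j k : ZMod n, seqMk (seqMap (cyclicAut hα j) (w ^ k.val * p))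
      = seqMk (w ^ k.val * p) := fun j k => by
    rw [← seqAut_seqMk]
    simp only [map_mul, map_pow, hpq, hwW]
    rw [seqAut_cyclicAut_fixed hαq, seqAut_cyclicAut_fixed hW5]
  -- The norm estimate concerns `z⋆ x z`, not compression by `z z⋆`; since `z` represents the
  -- selfadjoint `q`, they agree in the limit.
  have rel5 : seqMk (p * const ℕ x * p) = seqMk (star z * const ℕ x * z) := by
    simp only [map_mul, ← star_seqMk, hpq, ← hqz, hqs]
  have hnorm : Tendsto (fun m => (1 - δ m) ^ 6) atTop (𝓝 1) := by
    have : Tendsto (fun m => 1 - δ m) atTop (𝓝 (1 - 0)) := tendsto_const_nhds.sub hδ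
    simpa using this.pow 6
  have ev1 : ∀ᶠ m in atTop, ∀ a ∈ F, ‖p m * a - a * p m‖ < ε :=
    (Filter.eventually_all_finset F).2 fun a ha => eventually_norm_sub_lt (rel1 a ha) hε
  have ev2 : ∀ᶠ m in atTop, ∀ a ∈ F, ∀ k : ZMod n, ‖cyclicAut hα k (p m * a * p m)
      - w m ^ k.val * p m * (p m * a * p m) * star (w m ^ k.val * p m)‖ < ε := by
    refine (Filter.eventually_all_finset F).2 fun a ha => eventually_all.2 fun k => ?_
    have := eventually_norm_sub_lt (rel2 a ha k.val) hε
    rw [ZMod.natCast_zmod_val] at this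
    exact this
  have ev3 : ∀ᶠ m in atTop, ∀ j k : ZMod n, ‖w m ^ j.val * p m * (w m ^ k.val * p m)
      - w m ^ (j + k).val * p m‖ < ε :=
    eventually_all.2 fun j => eventually_all.2 fun k => eventually_norm_sub_lt (rel3 j k) hε
  have ev4 : ∀ᶠ m in atTop, ∀ j k : ZMod n, ‖cyclicAut hα j (w m ^ k.val * p m)
      - w m ^ k.val * p m‖ < ε :=
    eventually_all.2 fun j => eventually_all.2 fun k => eventually_norm_sub_lt (rel4 j k) hε
  -- The bound `1/2` is the one in `equivToProjIn_of_near`. The norm loss `ε` is halved between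
  -- replacing `z` by `p` and the factor `(1 - δ)^6`.
  obtain ⟨m, hwm, h1, h2, h3, h4, h5, h6, h7⟩ := (hw.and <| ev1.and <| ev2.and <| ev3.and <|
    ev4.and <| (eventually_norm_sub_lt hpz (half_pos one_pos)).and <|
    (eventually_norm_sub_lt rel5 (half_pos hε)).and <|
    hnorm.eventually_const_lt (show 1 - ε / 2 < 1 by linarith)).exists
  refine ⟨p m, fun k => w m ^ (Multiplicative.toAdd k).val * p m, hp m,
    fun k => hwm.pow_mul (hp m) _, h1, fun a ha k => h2 a ha (Multiplicative.toAdd k),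
    fun j k => h3 (Multiplicative.toAdd j) (Multiplicative.toAdd k),
    fun j k => h4 (Multiplicative.toAdd j) (Multiplicative.toAdd k), ?_, ?_⟩
  · obtain ⟨s, hs, hss⟩ := exists_sum_comparison (hE m) (D m).proj_g (hQ m) hy₁ hy₂ hy₃
      h12 h13 h23 hx₁ hx₂ hx₃ (D m).equiv_e (D m).equiv_g (D m).equiv_f
    refine equivToProjIn_of_near (hp m).one_sub hx.isSelfAdjoint hs ?_
    rw [hss, ← hzs, sub_sub_sub_cancel_left]
    exact h5.le
  · have hlt := (D m).norm_lt
    rw [hx1, mul_one] at hlt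
    have hzx : star (z m) * x * z m
        = (∑ k, f m k) * (g m * ((∑ k, e m k) * x * ∑ k, e m k) * g m) * ∑ k, f m k := by
      rw [hz, star_mul, star_mul, (hE m).isSelfAdjoint.star_eq,
        (hQ m).isSelfAdjoint.star_eq, (D m).proj_g.isSelfAdjoint.star_eq]
      noncomm_ring
    rw [← hzx] at hlt
    have h8 : ‖star (z m) * x * z m‖ - ‖p m * x * p m‖ < ε / 2 := by
      refine lt_of_le_of_lt (norm_sub_norm_le _ _) ?_
      rw [norm_sub_rev]
      exact h6
    linarith

end Main

end TracialActions

theorem mainTheorem3 {A : Type*} [CStarAlgebra A] [PartialOrder A] [StarOrderedRing A]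
    [TopologicalSpace.SeparableSpace A]
    (hinf : ¬ FiniteDimensional ℂ A)
    (hsimple : TracialActions.IsSimpleCStar A)
    (n : ℕ) [NeZero n] (α : A ≃⋆ₐ[ℂ] A) (hα : α ^ n = 1)
    (hinn : TracialActions.StronglyTraciallyApproxInner α)
    (hTRP : TracialActions.TracialRokhlinProperty (TracialActions.cyclicAction n α hα)) :
    TracialActions.TraciallyApproxRepresentable (TracialActions.cyclicAction n α hα) :=
  TracialActions.traciallyApproxRepresentable_cyclicAction hinf hsimple n α hα hinn hTRP
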